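/- Let $K$ be a commutative ring with unit. A $K$-linear $2$-category is a (strict) $2$-category $\mathfrak{C}$ whose hom-categories are $K$-linear and whose composition functors are $K$-bilinear on $2$-morphisms. A $K$-linear Gray semigroup is a $K$-linear $2$-category $\mathfrak{C}$ with a pseudofunctor $\otimes:\mathfrak{C}\times\mathfrak{C}\to\mathfrak{C}$ that * is cubical, i.e. it preserves identity $1$-morphisms strictly, and its structural $2$-isomorphisms $(f'\otimes 1)\circ(f\otimes g)\cong (f'\circ f)\otimes g$ and $(f\otimes g')\circ(1\otimes g)\cong f\otimes(g'\circ g)$ are identities, * is strictly associative, i.e. $\otimes\circ(\otimes\times 1)=\otimes\circ(1\times\otimes)$ as pseudofunctors $\mathfrak{C}^3\to\mathfrak{C}$, * is $K$-bilinear on $2$-morphisms. For $n\ge 1$ let $\otimes(n):\mathfrak{C}^n\to\mathfrak{C}$ be the iterated tensor product, with $\otimes(1)=\mathrm{id}$ and $\otimes(n+1)=\otimes\circ(\mathrm{id}\times\otimes(n))$. For a pseudofunctor $F:\mathfrak{A}\to\mathfrak{C}$ and $m\ge1$ let $X^m(F)$ be the $K$-module of all families of $2$-morphisms $$\varphi(f_0,\dots,f_{m-1}):\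 F(f_0)\circ\cdots\circ F(f_{m-1})\Longrightarrow F(f_0\circ\cdots\circ f_{m-1}),$$ indexed by the composable strings of $1$-morphisms of $\mathfrak{A}$ and natural in $(f_0,\dots,f_{m-1})$ for every choice of the $m+1$ objects $X_0,\dots,X_m$ (so $f_0$ is the $1$-morphism applied last). Put $X^{m-1,n-1}(\mathfrak{C})=X^m(\otimes(n))$ for $m,n\ge1$. For a $2$-morphism $\psi$ whose source and target agree with the required ones up to the structural $2$-isomorphisms of the pseudofunctor $\otimes(n)$ and of the pseudofunctors it is built from, $\lceil\psi\rceil$ denotes the composite of $\psi$ with the canonical such $2$-isomorphisms on both sides. Define $$\delta_h:X^{m-1,n-1}(\mathfrak{C})\to X^{m,n-1}(\mathfrak{C}),\qquad \delta_v:X^{m-1,n-1}(\mathfrak{C})\to X^{m-1,n}(\mathfrak{C})$$ by, with $F=\otimes(n)$, $$(\delta_h\varphi)(f_0,\dots,f_m)=\lceil 1_{F(f_0)}\circ\varphi(f_1,\dots,f_m)\rceil+\sum_{i=1}^{m}(-1)^i\lceil\varphi(f_0,\dots,f_{i-1}\circ f_i,\dots,f_m)\rceil+(-1)^{m+1}\lceil\varphi(f_0,\dots,f_{m-1})\circ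 1_{F(f_m)}\rceil ,$$ and, writing a string of $m$ composable $1$-morphisms of $\mathfrak{C}^{n+1}$ as $f_j=(f^0_j,\dots,f^n_j)$, $0\le j\le m-1$, and $f^i=(f^i_0,\dots,f^i_{m-1})$, and with $f^{i-1}\otimes f^i=(f^{i-1}_0\otimes f^i_0,\dots,f^{i-1}_{m-1}\otimes f^i_{m-1})$, $$(\delta_v\varphi)(f^0,\dots,f^n)=\lceil 1_{f^0_0\circ\cdots\circ f^0_{m-1}}\otimes\varphi(f^1,\dots,f^n)\rceil+\sum_{i=1}^{n}(-1)^i\lceil\varphi(f^0,\dots,f^{i-1}\otimes f^i,\dots,f^n)\rceil+(-1)^{n+1}\lceil\varphi(f^0,\dots,f^{n-1})\otimes 1_{f^n_0\circ\cdots\circ f^n_{m-1}}\rceil .$$ Theorem. For every $K$-linear Gray semigroup $\mathfrak{C}$, the $K$-modules $X^{p,q}(\mathfrak{C})$, $p,q\ge0$, with the $K$-linear maps $\delta_h$ and $\delta_v$ form a double complex: $\delta_h\circ\delta_h=0$, $\delta_v\circ\delta_v=0$ and $\delta_h\circ\delta_v=\delta_v\circ\delta_h$ on every $X^{p,q}(\mathfrak{C})$.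 -/

import Mathlib

open CategoryTheory Bicategory
open scoped CategoryTheory.Prod

universe w v u w₁ v₁ u₁ w₂ v₂ u₂ w₃ v₃ u₃

namespace GrayComplex

section Pseudofunctors

variable {B : Type u} [Bicategory.{w, v} B] {C : Type u₁} [Bicategory.{w₁, v₁} C]
  {D : Type u₂} [Bicategory.{w₂, v₂} D] {E : Type u₃} [Bicategory.{w₃, v₃} E]

/-- The pseudofunctor `(F, G) : B ⥤ᵖ C × D` with components `F` and `G`. -/
def pair (F : B ⥤ᵖ C) (G : B ⥤ᵖ D) : B ⥤ᵖ (C × D) where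
  obj X := (F.obj X, G.obj X)
  map f := (F.map f, G.map f)
  map₂ τ := (F.map₂ τ, G.map₂ τ)
  map₂_id f := Prod.ext (F.map₂_id f) (G.map₂_id f)
  map₂_comp σ τ := Prod.ext (F.map₂_comp σ τ) (G.map₂_comp σ τ)
  mapId X := Iso.prod (F.mapId X) (G.mapId X)
  mapComp f g := Iso.prod (F.mapComp f g) (G.mapComp f g)
  map₂_whisker_left f _ _ τ :=
    Prod.ext (F.map₂_whisker_left f τ) (G.map₂_whisker_left f τ)
  map₂_whisker_right τ h :=
    Prod.ext (F.map₂_whisker_right τ h) (G.map₂_whisker_right τ h)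
  map₂_associator f g h := Prod.ext (F.map₂_associator f g h) (G.map₂_associator f g h)
  map₂_left_unitor f := Prod.ext (F.map₂_left_unitor f) (G.map₂_left_unitor f)
  map₂_right_unitor f := Prod.ext (F.map₂_right_unitor f) (G.map₂_right_unitor f)

variable (C D) in
/-- The first projection `C × D ⥤ᵖ C`. -/
def proj₁ : (C × D) ⥤ᵖ C := (Bicategory.Prod.fst C D).toPseudofunctor

variable (C D) in
/-- The second projection `C × D ⥤ᵖ D`. -/
def proj₂ : (C × D) ⥤ᵖ D := (Bicategory.Prod.snd C D).toPseudofunctor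

theorem pseudofunctor_ext {F G : B ⥤ᵖ C} (h : F.toPrelaxFunctor = G.toPrelaxFunctor)
    (hid : ∀ X, HEq (F.mapId X).hom (G.mapId X).hom)
    (hcomp : ∀ {X Y Z : B} (f : X ⟶ Y) (g : Y ⟶ Z),
      HEq (F.mapComp f g).hom (G.mapComp f g).hom) : F = G := by
  cases F
  cases G
  dsimp at h
  subst h
  congr 1
  · funext X
    exact Iso.ext (eq_of_heq (hid X))
  · funext X Y Z f g
    exact Iso.ext (eq_of_heq (hcomp f g))

theorem comp_assoc (F : B ⥤ᵖ C) (G : C ⥤ᵖ D) (H : D ⥤ᵖ E) :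
    (F.comp G).comp H = F.comp (G.comp H) := by
  refine pseudofunctor_ext rfl (fun X => heq_of_eq ?_) (fun f g => heq_of_eq ?_)
  · change H.map₂ (G.map₂ (F.mapId X).hom ≫ (G.mapId (F.obj X)).hom) ≫ (H.mapId _).hom =
      H.map₂ (G.map₂ (F.mapId X).hom) ≫ H.map₂ (G.mapId (F.obj X)).hom ≫ (H.mapId _).hom
    rw [H.map₂_comp, Category.assoc]
  · change H.map₂ (G.map₂ (F.mapComp f g).hom ≫ (G.mapComp _ _).hom) ≫ (H.mapComp _ _).hom =
      H.map₂ (G.map₂ (F.mapComp f g).hom) ≫ H.map₂ (G.mapComp _ _).hom ≫ (H.mapComp _ _).hom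
    rw [H.map₂_comp, Category.assoc]

theorem id_comp (F : B ⥤ᵖ C) : (Pseudofunctor.id B).comp F = F := by
  refine pseudofunctor_ext rfl (fun X => heq_of_eq ?_) (fun f g => heq_of_eq ?_)
  · change F.map₂ (𝟙 _) ≫ (F.mapId X).hom = _
    rw [F.map₂_id]
    exact Category.id_comp _
  · change F.map₂ (𝟙 _) ≫ (F.mapComp f g).hom = _
    rw [F.map₂_id]
    exact Category.id_comp _

theorem comp_id (F : B ⥤ᵖ C) : F.comp (Pseudofunctor.id C) = F :=
  pseudofunctor_ext rfl (fun _ => heq_of_eq (Category.comp_id _))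
    (fun _ _ => heq_of_eq (Category.comp_id _))

theorem comp_pair (H : E ⥤ᵖ B) (F : B ⥤ᵖ C) (G : B ⥤ᵖ D) :
    H.comp (pair F G) = pair (H.comp F) (H.comp G) :=
  pseudofunctor_ext rfl (fun _ => HEq.rfl) (fun _ _ => HEq.rfl)

theorem pair_proj₁ (F : B ⥤ᵖ C) (G : B ⥤ᵖ D) : (pair F G).comp (proj₁ C D) = F :=
  pseudofunctor_ext rfl (fun _ => heq_of_eq (Category.comp_id _))
    (fun _ _ => heq_of_eq (Category.comp_id _))

theorem pair_proj₂ (F : B ⥤ᵖ C) (G : B ⥤ᵖ D) : (pair F G).comp (proj₂ C D) = G :=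
  pseudofunctor_ext rfl (fun _ => heq_of_eq (Category.comp_id _))
    (fun _ _ => heq_of_eq (Category.comp_id _))

theorem pair_proj : pair (proj₁ C D) (proj₂ C D) = Pseudofunctor.id (C × D) :=
  pseudofunctor_ext rfl (fun _ => HEq.rfl) (fun _ _ => HEq.rfl)

theorem naturality_aux₁ (F : C ⥤ᵖ D) {P Q R : C} {x x' : P ⟶ Q} (σ : x ⟶ x') {y y' : Q ⟶ R}
    (τ : y ⟶ y') {k k' : F.obj P ⟶ F.obj Q} (κ : k ⟶ k') (θ : k ⟶ F.map x) (θ' : k' ⟶ F.map x')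
    (h : κ ≫ θ' = θ ≫ F.map₂ σ) :
    (κ ▷ F.map y ≫ k' ◁ F.map₂ τ) ≫ θ' ▷ F.map y' ≫ (F.mapComp x' y').inv =
      (θ ▷ F.map y ≫ (F.mapComp x y).inv) ≫ F.map₂ (σ ▷ y ≫ x' ◁ τ) := by
  rw [Category.assoc, whisker_exchange_assoc, ← comp_whiskerRight_assoc, h]
  simp

theorem naturality_aux₂ {P Q R S : C} {f f' : P ⟶ Q} (σ : f ⟶ f') {l l' : Q ⟶ R} (ρ : l ⟶ l')
    {y y' : R ⟶ S} (τ : y ⟶ y') {k k' : P ⟶ R} (κ : k ⟶ k') (θ : f ≫ l ⟶ k) (θ' : f' ≫ l' ⟶ k')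
    (h : (σ ▷ l ≫ f' ◁ ρ) ≫ θ' = θ ≫ κ) :
    (σ ▷ (l ≫ y) ≫ f' ◁ (ρ ▷ y ≫ l' ◁ τ)) ≫ (α_ f' l' y').inv ≫ θ' ▷ y' =
      ((α_ f l y).inv ≫ θ ▷ y) ≫ κ ▷ y ≫ k' ◁ τ := by
  simp only [Category.assoc]
  rw [← comp_whiskerRight_assoc, ← h, comp_whiskerRight_assoc, ← whisker_exchange θ' τ]
  simp

theorem naturality_aux₃ (F : C ⥤ᵖ D) {P Q R : C} {f f' : P ⟶ Q} (σ : f ⟶ f') {m m' : Q ⟶ R}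
    (μ : m ⟶ m') {n n' : P ⟶ R} (ν : n ⟶ n') {k k' : F.obj P ⟶ F.obj R} (κ : k ⟶ k')
    {l l' : F.obj Q ⟶ F.obj R} (ρ : l ⟶ l') (θ : k ⟶ F.map f ≫ l) (θ' : k' ⟶ F.map f' ≫ l')
    (φ : l ⟶ F.map m) (φ' : l' ⟶ F.map m') (η : f ≫ m ⟶ n) (η' : f' ≫ m' ⟶ n')
    (hs : κ ≫ θ' = θ ≫ F.map₂ σ ▷ l ≫ F.map f' ◁ ρ) (hφ : ρ ≫ φ' = φ ≫ F.map₂ μ)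
    (ht : (σ ▷ m ≫ f' ◁ μ) ≫ η' = η ≫ ν) :
    κ ≫ θ' ≫ F.map f' ◁ φ' ≫ (F.mapComp f' m').inv ≫ F.map₂ η' =
      (θ ≫ F.map f ◁ φ ≫ (F.mapComp f m).inv ≫ F.map₂ η) ≫ F.map₂ ν := by
  simp only [Category.assoc]
  rw [← F.map₂_comp, ← ht, reassoc_of% hs, ← whiskerLeft_comp_assoc, hφ]
  simp [whisker_exchange_assoc]

end Pseudofunctors

section Strings

/-- `Str C p X Z` is the type of strings of `p + 2` objects of `C` that start at `X` and end
at `Z`, that is, a choice of `p` intermediate objects. -/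
inductive Str (C : Type u) : ℕ → C → C → Type u
  | nil (X Z : C) : Str C 0 X Z
  | cons {p : ℕ} {X Y : C} (s : Str C p X Y) (Z : C) : Str C (p + 1) X Z

namespace Str

/-- The image of a string of objects under a map. -/
def map {C : Type u} {D : Type u₁} (G : C → D) :
    ∀ {p : ℕ} {X Z : C}, Str C p X Z → Str D p (G X) (G Z)
  | _, _, _, .nil X Z => .nil (G X) (G Z)
  | _, _, _, .cons s Z => .cons (s.map G) (G Z)

/-- Delete one intermediate object: `i = 0` deletes the one next to the end `Z`, and so on. -/
def erase {C : Type u} : ∀ {p : ℕ} {X Z : C}, Str C (p + 1) X Z → ℕ → Str C p X Z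
  | _, _, _, .cons (.nil X _) Z, _ => .nil X Z
  | _, _, _, .cons (.cons s _) Z, 0 => .cons s Z
  | _, _, _, .cons (.cons s Y) Z, i + 1 => .cons ((Str.cons s Y).erase i) Z

/-- The second object of a string. -/
def second {C : Type u} : ∀ {p : ℕ} {X Z : C}, Str C (p + 1) X Z → C
  | _, _, _, .cons (.nil _ Y) _ => Y
  | _, _, _, .cons (.cons s Y) _ => (Str.cons s Y).second

/-- The string without its first object. -/
def tail {C : Type u} :
    ∀ {p : ℕ} {X Z : C} (s : Str C (p + 1) X Z), Str C p s.second Z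
  | _, _, _, .cons (.nil _ Y) Z => .nil Y Z
  | _, _, _, .cons (.cons s Y) Z => .cons (Str.cons s Y).tail Z

variable {C : Type u} [Bicategory.{w, v} C] {D : Type u₁} [Bicategory.{w₁, v₁} D]
  {E : Type u₂} [Bicategory.{w₂, v₂} E]

/-- For the string `X₀, …, X_{p+1}`, the type of composable 1-morphisms `(f₀, …, f_p)` with
`f_i : X_{p-i} ⟶ X_{p+1-i}`; thus `f₀` is the one applied last. -/
def Chain : ∀ {p : ℕ} {X Z : C}, Str C p X Z → Type v
  | _, _, _, .nil X Z => X ⟶ Z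
  | _, _, _, .cons (Y := Y) s Z => (Y ⟶ Z) × s.Chain

/-- The product category `C(X_p, X_{p+1}) × ⋯ × C(X₀, X₁)`. -/
instance chainCategory : ∀ {p : ℕ} {X Z : C} (s : Str C p X Z), Category.{w} s.Chain
  | _, _, _, .nil X Z => inferInstanceAs (Category.{w} (X ⟶ Z))
  | _, _, _, .cons (Y := Y) s Z =>
    letI := s.chainCategory
    inferInstanceAs (Category.{w} ((Y ⟶ Z) × s.Chain))

/-- The composition functor `C(Y, Z) × C(X, Y) ⥤ C(X, Z)`, `(f, g) ↦ f ∘ g`. -/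
def hcomp (X Y Z : C) : (Y ⟶ Z) × (X ⟶ Y) ⥤ (X ⟶ Z) where
  obj c := c.2 ≫ c.1
  map {c c'} τ := τ.2 ▷ c.1 ≫ c'.2 ◁ τ.1
  map_id c := by simp
  map_comp σ τ := by simp [← whisker_exchange_assoc]

/-- The iterated composition functor `(f₀, …, f_p) ↦ f₀ ∘ ⋯ ∘ f_p`. -/
def comp : ∀ {p : ℕ} {X Z : C} (s : Str C p X Z), s.Chain ⥤ (X ⟶ Z)
  | _, _, _, .nil X Z => 𝟭 (X ⟶ Z)
  | _, X, _, .cons (Y := Y) s Z => (𝟭 (Y ⟶ Z)).prod s.comp ⋙ hcomp X Y Z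

/-- The functor `(f₀, …, f_p) ↦ (F(f₀), …, F(f_p))`. -/
def mapChain (F : C ⥤ᵖ D) :
    ∀ {p : ℕ} {X Z : C} (s : Str C p X Z), s.Chain ⥤ (s.map F.obj).Chain
  | _, _, _, .nil X Z => F.mapFunctor X Z
  | _, _, _, .cons (Y := Y) s Z => (F.mapFunctor Y Z).prod (s.mapChain F)

/-- The functor `C F : (f₀, …, f_p) ↦ F(f₀) ∘ ⋯ ∘ F(f_p)`. -/
def compMap (F : C ⥤ᵖ D) {p : ℕ} {X Z : C} (s : Str C p X Z) :
    s.Chain ⥤ (F.obj X ⟶ F.obj Z) :=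
  s.mapChain F ⋙ (s.map F.obj).comp

/-- The functor `F C : (f₀, …, f_p) ↦ F(f₀ ∘ ⋯ ∘ f_p)`. -/
def mapComp (F : C ⥤ᵖ D) {p : ℕ} {X Z : C} (s : Str C p X Z) :
    s.Chain ⥤ (F.obj X ⟶ F.obj Z) :=
  s.comp ⋙ F.mapFunctor X Z

theorem compMap_comp (G : C ⥤ᵖ D) (F : D ⥤ᵖ E) :
    ∀ {p : ℕ} {X Z : C} (s : Str C p X Z),
      s.compMap (G.comp F) = s.mapChain G ⋙ (s.map G.obj).compMap F
  | _, _, _, .nil X Z => rfl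
  | _, X, _, .cons (Y := Y) s Z => by
    have h := compMap_comp G F s
    change ((G.comp F).mapFunctor Y Z).prod (s.compMap (G.comp F)) ⋙ hcomp _ _ _ = _
    rw [h]
    rfl

/-- The functor `(f₀, …, f_p) ↦ (f₀, …, f_i ∘ f_{i+1}, …, f_p)`, where `i < p`. -/
def merge : ∀ {p : ℕ} {X Z : C} (s : Str C (p + 1) X Z) (i : ℕ), s.Chain ⥤ (s.erase i).Chain
  | _, _, _, .cons (.nil X Y) Z, _ => hcomp X Y Z
  | _, _, _, .cons (.cons (Y := W) s Y) Z, 0 =>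
    (prod.inverseAssociator (Y ⟶ Z) (W ⟶ Y) s.Chain) ⋙ (hcomp W Y Z).prod (𝟭 s.Chain)
  | _, _, _, .cons (.cons s Y) Z, i + 1 => (𝟭 (Y ⟶ Z)).prod ((Str.cons s Y).merge i)

/-- The functor `(f₀, …, f_p) ↦ f_p`. -/
def firstMor : ∀ {p : ℕ} {X Z : C} (s : Str C (p + 1) X Z), s.Chain ⥤ (X ⟶ s.second)
  | _, _, _, .cons (.nil X Y) Z => CategoryTheory.Prod.snd (Y ⟶ Z) (X ⟶ Y)
  | _, _, _, .cons (.cons s Y) Z =>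
    CategoryTheory.Prod.snd (Y ⟶ Z) (Str.cons s Y).Chain ⋙ (Str.cons s Y).firstMor

/-- The functor `(f₀, …, f_p) ↦ (f₀, …, f_{p-1})`. -/
def tailChain : ∀ {p : ℕ} {X Z : C} (s : Str C (p + 1) X Z), s.Chain ⥤ s.tail.Chain
  | _, _, _, .cons (.nil X Y) Z => CategoryTheory.Prod.fst (Y ⟶ Z) (X ⟶ Y)
  | _, _, _, .cons (.cons s Y) Z => ((𝟭 (Y ⟶ Z)).prod (Str.cons s Y).tailChain :
      (Y ⟶ Z) × (Str.cons s Y).Chain ⥤ (Y ⟶ Z) × (Str.cons s Y).tail.Chain)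

/-! The canonical 2-morphisms (expansions of the structural 2-isomorphisms of `F` and of the
associativity constraints) out of which the padding operators are built. In a 2-category
all associativity constraints are identities. -/

/-- The canonical 2-morphism `F(f₀) ∘ ⋯ ∘ F(f_p) ⟹ F(f₀ ∘ ⋯ ∘ f_p)`. -/
def coh (F : C ⥤ᵖ D) : ∀ {p : ℕ} {X Z : C} (s : Str C p X Z), s.compMap F ⟶ s.mapComp F
  | _, _, _, .nil X Z => 𝟙 (F.mapFunctor X Z)
  | _, X, _, .cons (Y := Y) s Z =>
    { app := fun (c : (Y ⟶ Z) × s.Chain) =>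
        (s.coh F).app c.2 ▷ F.map c.1 ≫ (F.mapComp (s.comp.obj c.2) c.1).inv
      naturality := by
        intro (c : (Y ⟶ Z) × s.Chain) (c' : (Y ⟶ Z) × s.Chain) (τ : c ⟶ c')
        exact naturality_aux₁ F (s.comp.map τ.2) τ.1 ((s.compMap F).map τ.2) _ _
          ((s.coh F).naturality τ.2) }

/-- The canonical 2-morphism
`F(f₀) ∘ ⋯ ∘ F(f_p) ⟹ F(f₀) ∘ ⋯ ∘ F(f_i ∘ f_{i+1}) ∘ ⋯ ∘ F(f_p)`. -/
def mergeSource (F : C ⥤ᵖ D) : ∀ {p : ℕ} {X Z : C} (s : Str C (p + 1) X Z) (i : ℕ),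
    s.compMap F ⟶ s.merge i ⋙ (s.erase i).compMap F
  | _, _, _, .cons (.nil X Y) Z, _ =>
    { app := fun (c : (Y ⟶ Z) × (X ⟶ Y)) => (F.mapComp c.2 c.1).inv
      naturality := by
        intro (c : (Y ⟶ Z) × (X ⟶ Y)) (c' : (Y ⟶ Z) × (X ⟶ Y)) (τ : c ⟶ c')
        change (F.map₂ τ.2 ▷ F.map c.1 ≫ F.map c'.2 ◁ F.map₂ τ.1) ≫ (F.mapComp c'.2 c'.1).inv =
          (F.mapComp c.2 c.1).inv ≫ F.map₂ (τ.2 ▷ c.1 ≫ c'.2 ◁ τ.1)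
        simp }
  | _, _, _, .cons (.cons (Y := W) s Y) Z, 0 =>
    { app := fun (c : (Y ⟶ Z) × (W ⟶ Y) × s.Chain) =>
        (α_ ((s.compMap F).obj c.2.2) (F.map c.2.1) (F.map c.1)).hom ≫
          (s.compMap F).obj c.2.2 ◁ (F.mapComp c.2.1 c.1).inv
      naturality := by
        intro (c : (Y ⟶ Z) × (W ⟶ Y) × s.Chain) (c' : (Y ⟶ Z) × (W ⟶ Y) × s.Chain) (τ : c ⟶ c')
        let K := s.compMap F
        change ((K.map τ.2.2 ▷ F.map c.2.1 ≫ K.obj c'.2.2 ◁ F.map₂ τ.2.1) ▷ F.map c.1 ≫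
            (K.obj c'.2.2 ≫ F.map c'.2.1) ◁ F.map₂ τ.1) ≫
            (α_ (K.obj c'.2.2) (F.map c'.2.1) (F.map c'.1)).hom ≫
              K.obj c'.2.2 ◁ (F.mapComp c'.2.1 c'.1).inv =
          ((α_ (K.obj c.2.2) (F.map c.2.1) (F.map c.1)).hom ≫
            K.obj c.2.2 ◁ (F.mapComp c.2.1 c.1).inv) ≫
            K.map τ.2.2 ▷ F.map (c.2.1 ≫ c.1) ≫
              K.obj c'.2.2 ◁ F.map₂ (τ.2.1 ▷ c.1 ≫ c'.2.1 ◁ τ.1)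
        simp [whisker_exchange_assoc] }
  | _, _, _, .cons (.cons s Y) Z, i + 1 =>
    { app := fun (c : (Y ⟶ Z) × (Str.cons s Y).Chain) =>
        ((Str.cons s Y).mergeSource F i).app c.2 ▷ F.map c.1
      naturality := by
        intro (c : (Y ⟶ Z) × (Str.cons s Y).Chain) (c' : (Y ⟶ Z) × (Str.cons s Y).Chain) (τ : c ⟶ c')
        have h := ((Str.cons s Y).mergeSource F i).naturality τ.2
        let K := (Str.cons s Y).compMap F
        let L := (Str.cons s Y).merge i ⋙ ((Str.cons s Y).erase i).compMap F
        let θ : K ⟶ L := (Str.cons s Y).mergeSource F i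
        change (K.map τ.2 ▷ F.map c.1 ≫ K.obj c'.2 ◁ F.map₂ τ.1) ≫ θ.app c'.2 ▷ F.map c'.1 =
          θ.app c.2 ▷ F.map c.1 ≫ L.map τ.2 ▷ F.map c.1 ≫ L.obj c'.2 ◁ F.map₂ τ.1
        change K.map τ.2 ≫ θ.app c'.2 = θ.app c.2 ≫ L.map τ.2 at h
        rw [Category.assoc, whisker_exchange, ← comp_whiskerRight_assoc, h]
        simp }

/-- The canonical (identity) 2-morphism `f₀ ∘ ⋯ ∘ (f_i ∘ f_{i+1}) ∘ ⋯ ∘ f_p ⟹ f₀ ∘ ⋯ ∘ f_p`. -/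
def mergeTarget : ∀ {p : ℕ} {X Z : C} (s : Str C (p + 1) X Z) (i : ℕ),
    s.merge i ⋙ (s.erase i).comp ⟶ s.comp
  | _, _, _, .cons (.nil X Y) Z, _ => 𝟙 (hcomp X Y Z)
  | _, _, _, .cons (.cons (Y := W) s Y) Z, 0 =>
    { app := fun (c : (Y ⟶ Z) × (W ⟶ Y) × s.Chain) => (α_ (s.comp.obj c.2.2) c.2.1 c.1).inv
      naturality := by
        intro (c : (Y ⟶ Z) × (W ⟶ Y) × s.Chain) (c' : (Y ⟶ Z) × (W ⟶ Y) × s.Chain) (τ : c ⟶ c')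
        let K := s.comp
        change (K.map τ.2.2 ▷ (c.2.1 ≫ c.1) ≫ K.obj c'.2.2 ◁ (τ.2.1 ▷ c.1 ≫ c'.2.1 ◁ τ.1)) ≫
            (α_ (K.obj c'.2.2) c'.2.1 c'.1).inv =
          (α_ (K.obj c.2.2) c.2.1 c.1).inv ≫
            (K.map τ.2.2 ▷ c.2.1 ≫ K.obj c'.2.2 ◁ τ.2.1) ▷ c.1 ≫
              (K.obj c'.2.2 ≫ c'.2.1) ◁ τ.1
        simp }
  | _, _, _, .cons (.cons s Y) Z, i + 1 =>
    { app := fun (c : (Y ⟶ Z) × (Str.cons s Y).Chain) =>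
        ((Str.cons s Y).mergeTarget i).app c.2 ▷ c.1
      naturality := by
        intro (c : (Y ⟶ Z) × (Str.cons s Y).Chain) (c' : (Y ⟶ Z) × (Str.cons s Y).Chain) (τ : c ⟶ c')
        have h := ((Str.cons s Y).mergeTarget i).naturality τ.2
        let K := (Str.cons s Y).merge i ⋙ ((Str.cons s Y).erase i).comp
        let L := (Str.cons s Y).comp
        let θ : K ⟶ L := (Str.cons s Y).mergeTarget i
        change (K.map τ.2 ▷ c.1 ≫ K.obj c'.2 ◁ τ.1) ≫ θ.app c'.2 ▷ c'.1 =
          θ.app c.2 ▷ c.1 ≫ L.map τ.2 ▷ c.1 ≫ L.obj c'.2 ◁ τ.1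
        change K.map τ.2 ≫ θ.app c'.2 = θ.app c.2 ≫ L.map τ.2 at h
        rw [Category.assoc, whisker_exchange, ← comp_whiskerRight_assoc, h]
        simp }

/-- The functor `(f₀, …, f_p) ↦ (F(f₀) ∘ ⋯ ∘ F(f_{p-1})) ∘ F(f_p)`. -/
def splitMap (F : C ⥤ᵖ D) {p : ℕ} {X Z : C} (s : Str C (p + 1) X Z) :
    s.Chain ⥤ (F.obj X ⟶ F.obj Z) :=
  (s.tailChain ⋙ s.tail.compMap F).prod' (s.firstMor ⋙ F.mapFunctor X s.second) ⋙
    hcomp (F.obj X) (F.obj s.second) (F.obj Z)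

/-- The functor `(f₀, …, f_p) ↦ (f₀ ∘ ⋯ ∘ f_{p-1}) ∘ f_p`. -/
def splitComp {p : ℕ} {X Z : C} (s : Str C (p + 1) X Z) : s.Chain ⥤ (X ⟶ Z) :=
  (s.tailChain ⋙ s.tail.comp).prod' s.firstMor ⋙ hcomp X s.second Z

/-- The canonical (identity) 2-morphism
`F(f₀) ∘ ⋯ ∘ F(f_p) ⟹ (F(f₀) ∘ ⋯ ∘ F(f_{p-1})) ∘ F(f_p)`. -/
def splitSource (F : C ⥤ᵖ D) : ∀ {p : ℕ} {X Z : C} (s : Str C (p + 1) X Z),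
    s.compMap F ⟶ s.splitMap F
  | _, _, _, .cons (.nil X Y) Z => 𝟙 ((Str.cons (.nil X Y) Z).compMap F)
  | _, _, _, .cons (.cons s Y) Z =>
    { app := fun (c : (Y ⟶ Z) × (Str.cons s Y).Chain) =>
        ((Str.cons s Y).splitSource F).app c.2 ▷ F.map c.1 ≫
          (α_ (F.map ((Str.cons s Y).firstMor.obj c.2))
            (((Str.cons s Y).tail.compMap F).obj ((Str.cons s Y).tailChain.obj c.2))
            (F.map c.1)).hom
      naturality := by
        intro (c : (Y ⟶ Z) × (Str.cons s Y).Chain) (c' : (Y ⟶ Z) × (Str.cons s Y).Chain) (τ : c ⟶ c')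
        have h := ((Str.cons s Y).splitSource F).naturality τ.2
        let K := (Str.cons s Y).compMap F
        let f := (Str.cons s Y).firstMor ⋙ F.mapFunctor _ _
        let L := (Str.cons s Y).tailChain ⋙ (Str.cons s Y).tail.compMap F
        let θ : ∀ x, K.obj x ⟶ f.obj x ≫ L.obj x := ((Str.cons s Y).splitSource F).app
        change K.map τ.2 ≫ θ c'.2 = θ c.2 ≫ f.map τ.2 ▷ L.obj c.2 ≫ f.obj c'.2 ◁ L.map τ.2 at h
        change (K.map τ.2 ▷ F.map c.1 ≫ K.obj c'.2 ◁ F.map₂ τ.1) ≫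
            θ c'.2 ▷ F.map c'.1 ≫ (α_ (f.obj c'.2) (L.obj c'.2) (F.map c'.1)).hom =
          (θ c.2 ▷ F.map c.1 ≫ (α_ (f.obj c.2) (L.obj c.2) (F.map c.1)).hom) ≫
            f.map τ.2 ▷ (L.obj c.2 ≫ F.map c.1) ≫
              f.obj c'.2 ◁ (L.map τ.2 ▷ F.map c.1 ≫ L.obj c'.2 ◁ F.map₂ τ.1)
        rw [Category.assoc, whisker_exchange_assoc, ← comp_whiskerRight_assoc, h]
        simp }

/-- The canonical (identity) 2-morphism `(f₀ ∘ ⋯ ∘ f_{p-1}) ∘ f_p ⟹ f₀ ∘ ⋯ ∘ f_p`. -/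
def splitTarget : ∀ {p : ℕ} {X Z : C} (s : Str C (p + 1) X Z), s.splitComp ⟶ s.comp
  | _, _, _, .cons (.nil X Y) Z => 𝟙 (Str.cons (.nil X Y) Z).comp
  | _, _, _, .cons (.cons s Y) Z =>
    { app := fun (c : (Y ⟶ Z) × (Str.cons s Y).Chain) =>
        (α_ ((Str.cons s Y).firstMor.obj c.2)
            ((Str.cons s Y).tail.comp.obj ((Str.cons s Y).tailChain.obj c.2)) c.1).inv ≫
          ((Str.cons s Y).splitTarget).app c.2 ▷ c.1
      naturality := by
        intro (c : (Y ⟶ Z) × (Str.cons s Y).Chain) (c' : (Y ⟶ Z) × (Str.cons s Y).Chain) (τ : c ⟶ c')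
        exact naturality_aux₂ ((Str.cons s Y).firstMor.map τ.2)
          (((Str.cons s Y).tailChain ⋙ (Str.cons s Y).tail.comp).map τ.2) τ.1
          ((Str.cons s Y).comp.map τ.2) _ _ ((Str.cons s Y).splitTarget.naturality τ.2) }

/-- For `T : A × B ⥤ᵖ E`, written `T(f, g) = f ⊗ g`, and pseudofunctors `G`, `F`, the canonical
2-morphism `(G(f₀) ⊗ F(f₀)) ∘ ⋯ ∘ (G(f_p) ⊗ F(f_p)) ⟹ (G(f₀) ∘ ⋯ ∘ G(f_p)) ⊗ (F(f₀) ∘ ⋯ ∘ F(f_p))`. -/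
def pairSource {A : Type u₃} [Bicategory.{w₃, v₃} A] (T : (A × D) ⥤ᵖ E) (G : C ⥤ᵖ A)
    (F : C ⥤ᵖ D) : ∀ {p : ℕ} {X Z : C} (s : Str C p X Z),
      s.compMap ((pair G F).comp T) ⟶ (s.compMap G).prod' (s.compMap F) ⋙
        T.mapFunctor (G.obj X, F.obj X) (G.obj Z, F.obj Z)
  | _, _, _, .nil X Z => 𝟙 (((pair G F).comp T).mapFunctor X Z)
  | _, X, _, .cons (Y := Y) s Z =>
    { app := fun (c : (Y ⟶ Z) × s.Chain) =>
        (s.pairSource T G F).app c.2 ▷ T.map (G.map c.1 ×ₘ F.map c.1) ≫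
          (T.mapComp ((s.compMap G).obj c.2 ×ₘ (s.compMap F).obj c.2)
            (G.map c.1 ×ₘ F.map c.1)).inv
      naturality := by
        intro (c : (Y ⟶ Z) × s.Chain) (c' : (Y ⟶ Z) × s.Chain) (τ : c ⟶ c')
        exact naturality_aux₁ T (((s.compMap G).prod' (s.compMap F)).map τ.2)
          ((G.map₂ τ.1, F.map₂ τ.1) : (G.map c.1 ×ₘ F.map c.1) ⟶ (G.map c'.1 ×ₘ F.map c'.1))
          ((s.compMap ((pair G F).comp T)).map τ.2) _ _ ((s.pairSource T G F).naturality τ.2) }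

end Str
end Strings

section Linear

/-- For a bicategory `B` whose hom-categories are `K`-linear: the composition functors
`B(X, Y) × B(Y, Z) ⥤ B(X, Z)` are `K`-bilinear on 2-morphisms. For a 2-category `B` this says that
`B` is a `K`-linear 2-category. -/
class IsLinear (K : Type*) [CommRing K] (B : Type u) [Bicategory.{w, v} B]
    [∀ X Y : B, Preadditive (X ⟶ Y)] [∀ X Y : B, Linear K (X ⟶ Y)] : Prop where
  whiskerLeft_add : ∀ {X Y Z : B} (f : X ⟶ Y) {g g' : Y ⟶ Z} (σ τ : g ⟶ g'),
    f ◁ (σ + τ) = f ◁ σ + f ◁ τ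
  whiskerLeft_smul : ∀ {X Y Z : B} (f : X ⟶ Y) {g g' : Y ⟶ Z} (r : K) (σ : g ⟶ g'),
    f ◁ (r • σ) = r • (f ◁ σ)
  add_whiskerRight : ∀ {X Y Z : B} {f f' : X ⟶ Y} (σ τ : f ⟶ f') (g : Y ⟶ Z),
    (σ + τ) ▷ g = σ ▷ g + τ ▷ g
  smul_whiskerRight : ∀ {X Y Z : B} {f f' : X ⟶ Y} (r : K) (σ : f ⟶ f') (g : Y ⟶ Z),
    (r • σ) ▷ g = r • (σ ▷ g)

end Linear

section Cochains

variable {C : Type u} [Bicategory.{w, v} C] {D : Type u₁} [Bicategory.{w₁, v₁} D]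

/-- The cochains `X^{p+1}(F) = ∏ Nat(C F, F C)`, the product being over all strings `X₀, …, X_{p+1}`
of objects: an element is a family of 2-morphisms
`φ(f₀, …, f_p) : F(f₀) ∘ ⋯ ∘ F(f_p) ⟹ F(f₀ ∘ ⋯ ∘ f_p)` natural in `(f₀, …, f_p)`. -/
abbrev Cochain (F : C ⥤ᵖ D) (p : ℕ) : Type _ :=
  ∀ (X Z : C) (s : Str C p X Z), s.compMap F ⟶ s.mapComp F

/-- The term `⌈1_{F(f₀)} ∘ φ(f₁, …, f_{p+1})⌉` of the coboundary. -/
def rowFirst (F : C ⥤ᵖ D) {p : ℕ} (φ : Cochain F p) :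
    ∀ {X Z : C} (s : Str C (p + 1) X Z), s.compMap F ⟶ s.mapComp F
  | X, _, .cons (Y := Y) s Z =>
    { app := fun (c : (Y ⟶ Z) × s.Chain) =>
        (φ X Y s).app c.2 ▷ F.map c.1 ≫ (F.mapComp (s.comp.obj c.2) c.1).inv
      naturality := by
        intro (c : (Y ⟶ Z) × s.Chain) (c' : (Y ⟶ Z) × s.Chain) (τ : c ⟶ c')
        exact naturality_aux₁ F (s.comp.map τ.2) τ.1 ((s.compMap F).map τ.2) _ _
          ((φ X Y s).naturality τ.2) }

/-- The term `⌈φ(f₀, …, f_i ∘ f_{i+1}, …, f_{p+1})⌉` of the coboundary. -/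
def rowMiddle (F : C ⥤ᵖ D) {p : ℕ} (i : ℕ) (φ : Cochain F p) {X Z : C}
    (s : Str C (p + 1) X Z) : s.compMap F ⟶ s.mapComp F :=
  s.mergeSource F i ≫ Functor.whiskerLeft (s.merge i) (φ X Z (s.erase i)) ≫
    Functor.whiskerRight (s.mergeTarget i) (F.mapFunctor X Z)

/-- The term `⌈φ(f₀, …, f_p) ∘ 1_{F(f_{p+1})}⌉` of the coboundary. -/
def rowLast (F : C ⥤ᵖ D) {p : ℕ} (φ : Cochain F p) {X Z : C}
    (s : Str C (p + 1) X Z) : s.compMap F ⟶ s.mapComp F where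
  app c := (s.splitSource F).app c ≫
    F.map (s.firstMor.obj c) ◁ (φ s.second Z s.tail).app (s.tailChain.obj c) ≫
      (F.mapComp (s.firstMor.obj c) (s.tail.comp.obj (s.tailChain.obj c))).inv ≫
        F.map₂ (s.splitTarget.app c)
  naturality c c' τ := by
    exact naturality_aux₃ F (s.firstMor.map τ) (s.tail.comp.map (s.tailChain.map τ))
      (s.comp.map τ) ((s.compMap F).map τ) ((s.tail.compMap F).map (s.tailChain.map τ))
      _ _ _ _ _ _ ((s.splitSource F).naturality τ)
      ((φ s.second Z s.tail).naturality (s.tailChain.map τ)) (s.splitTarget.naturality τ)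

section

variable {K : Type*} [CommRing K] [∀ X Y : D, Preadditive (X ⟶ Y)]
  [∀ X Y : D, Linear K (X ⟶ Y)]

theorem comp_add_comp {X Y : D} {a b c d : X ⟶ Y} (x : a ⟶ b) (y y' : b ⟶ c) (z : c ⟶ d) :
    x ≫ (y + y') ≫ z = x ≫ y ≫ z + x ≫ y' ≫ z := by simp

theorem comp_smul_comp {X Y : D} {a b c d : X ⟶ Y} (r : K) (x : a ⟶ b) (y : b ⟶ c) (z : c ⟶ d) :
    x ≫ (r • y) ≫ z = r • (x ≫ y ≫ z) := by simp

theorem rowFirst_add [IsLinear K D] (F : C ⥤ᵖ D) {p : ℕ} (φ ψ : Cochain F p) {X Z : C}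
    (s : Str C (p + 1) X Z) : rowFirst F (φ + ψ) s = rowFirst F φ s + rowFirst F ψ s := by
  cases s with
  | cons s Z =>
    ext c
    exact (congrArg (· ≫ _) (IsLinear.add_whiskerRight (K := K) _ _ _)).trans
      (Preadditive.add_comp _ _ _ _ _ _)

theorem rowFirst_smul [IsLinear K D] (F : C ⥤ᵖ D) {p : ℕ} (r : K) (φ : Cochain F p) {X Z : C}
    (s : Str C (p + 1) X Z) : rowFirst F (r • φ) s = r • rowFirst F φ s := by
  cases s with
  | cons s Z =>
    ext c
    exact (congrArg (· ≫ _) (IsLinear.smul_whiskerRight (K := K) _ _ _)).trans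
      (Linear.smul_comp _ _ _ _ _ _)

theorem rowMiddle_add (F : C ⥤ᵖ D) {p : ℕ} (i : ℕ) (φ ψ : Cochain F p) {X Z : C}
    (s : Str C (p + 1) X Z) : rowMiddle F i (φ + ψ) s = rowMiddle F i φ s + rowMiddle F i ψ s := by
  ext c
  exact comp_add_comp _ _ _ _

theorem rowMiddle_smul (F : C ⥤ᵖ D) {p : ℕ} (i : ℕ) (r : K) (φ : Cochain F p) {X Z : C}
    (s : Str C (p + 1) X Z) : rowMiddle F i (r • φ) s = r • rowMiddle F i φ s := by
  ext c
  exact comp_smul_comp _ _ _ _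

theorem rowLast_add [IsLinear K D] (F : C ⥤ᵖ D) {p : ℕ} (φ ψ : Cochain F p) {X Z : C}
    (s : Str C (p + 1) X Z) : rowLast F (φ + ψ) s = rowLast F φ s + rowLast F ψ s := by
  ext c
  exact (congrArg (fun x => _ ≫ x ≫ _) (IsLinear.whiskerLeft_add (K := K) _ _ _)).trans
    (comp_add_comp _ _ _ _)

theorem rowLast_smul [IsLinear K D] (F : C ⥤ᵖ D) {p : ℕ} (r : K) (φ : Cochain F p) {X Z : C}
    (s : Str C (p + 1) X Z) : rowLast F (r • φ) s = r • rowLast F φ s := by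
  ext c
  exact (congrArg (fun x => _ ≫ x ≫ _) (IsLinear.whiskerLeft_smul (K := K) _ _ _)).trans
    (comp_smul_comp _ _ _ _)

end

/-- The coboundary `δ : X^{p+1}(F) ⟶ X^{p+2}(F)` of the deformation complex of `F`. -/
def rowCoboundary (K : Type*) [CommRing K] [∀ X Y : D, Preadditive (X ⟶ Y)]
    [∀ X Y : D, Linear K (X ⟶ Y)] [IsLinear K D] (F : C ⥤ᵖ D) (p : ℕ) :
    Cochain F p →ₗ[K] Cochain F (p + 1) where
  toFun φ X Z s := rowFirst F φ s +
    ∑ i ∈ Finset.range (p + 1), (-1 : K) ^ (i + 1) • rowMiddle F i φ s +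
      (-1 : K) ^ (p + 2) • rowLast F φ s
  map_add' φ ψ := by
    funext X Z s
    simp only [Pi.add_apply, rowFirst_add (K := K), rowMiddle_add, rowLast_add (K := K), smul_add,
      Finset.sum_add_distrib]
    abel
  map_smul' r φ := by
    funext X Z s
    simp only [Pi.smul_apply, rowFirst_smul, rowMiddle_smul, rowLast_smul, smul_add,
      Finset.smul_sum, RingHom.id_apply, smul_comm r]

/-- The pullback of `φ ∈ X^{p+1}(F)` along `G`, namely
`⌈φ(G(f₀), …, G(f_p))⌉ : F(G(f₀)) ∘ ⋯ ∘ F(G(f_p)) ⟹ F(G(f₀ ∘ ⋯ ∘ f_p))`. -/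
def pullback {E : Type u₂} [Bicategory.{w₂, v₂} E] (G : C ⥤ᵖ D) (F : D ⥤ᵖ E) {p : ℕ}
    (φ : Cochain F p) : Cochain (G.comp F) p := fun X Z s =>
  eqToHom (s.compMap_comp G F) ≫
    Functor.whiskerLeft (s.mapChain G) (φ (G.obj X) (G.obj Z) (s.map G.obj)) ≫
      Functor.whiskerRight (s.coh G) (F.mapFunctor (G.obj X) (G.obj Z))

/-- Transport of cochains along an equality of pseudofunctors. -/
def transport {F G : C ⥤ᵖ D} (h : F = G) {p : ℕ} (φ : Cochain F p) : Cochain G p := h ▸ φ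

/-- For `T : A × D ⥤ᵖ E`, written `T(f, g) = f ⊗ g`, and cochains `α` and `β` of `G` and `F`, the
cochain `⌈α(f₀, …, f_p) ⊗ β(f₀, …, f_p)⌉` of the pseudofunctor `G ⊗ F`:
`(G(f₀) ⊗ F(f₀)) ∘ ⋯ ∘ (G(f_p) ⊗ F(f_p)) ⟹ (G(f₀) ∘ ⋯ ∘ G(f_p)) ⊗ (F(f₀) ∘ ⋯ ∘ F(f_p)) ⟹
G(f₀ ∘ ⋯ ∘ f_p) ⊗ F(f₀ ∘ ⋯ ∘ f_p)`. -/
def tensorCochain {A : Type u₃} [Bicategory.{w₃, v₃} A] {E : Type u₂} [Bicategory.{w₂, v₂} E]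
    (T : (A × D) ⥤ᵖ E) (G : C ⥤ᵖ A) (F : C ⥤ᵖ D) {p : ℕ} (α : Cochain G p) (β : Cochain F p) :
    Cochain ((pair G F).comp T) p := fun X Z s =>
  s.pairSource T G F ≫ Functor.whiskerRight (NatTrans.prod' (α X Z s) (β X Z s))
    (T.mapFunctor (G.obj X, F.obj X) (G.obj Z, F.obj Z))

/-- The canonical cochain of `F`, formed by the canonical 2-morphisms. -/
def canonical (F : C ⥤ᵖ D) (p : ℕ) : Cochain F p := fun _ _ s => s.coh F

section

variable {K : Type*} [CommRing K]

theorem pullback_add {E : Type u₂} [Bicategory.{w₂, v₂} E] [∀ X Y : E, Preadditive (X ⟶ Y)]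
    (G : C ⥤ᵖ D) (F : D ⥤ᵖ E) {p : ℕ} (φ ψ : Cochain F p) :
    pullback G F (φ + ψ) = pullback G F φ + pullback G F ψ := by
  funext X Z s
  ext c
  exact comp_add_comp _ _ _ _

theorem pullback_smul {E : Type u₂} [Bicategory.{w₂, v₂} E] [∀ X Y : E, Preadditive (X ⟶ Y)]
    [∀ X Y : E, Linear K (X ⟶ Y)] (G : C ⥤ᵖ D) (F : D ⥤ᵖ E) {p : ℕ} (r : K) (φ : Cochain F p) :
    pullback G F (r • φ) = r • pullback G F φ := by
  funext X Z s
  ext c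
  exact comp_smul_comp _ _ _ _

theorem transport_add [∀ X Y : D, Preadditive (X ⟶ Y)] {F G : C ⥤ᵖ D} (h : F = G) {p : ℕ}
    (φ ψ : Cochain F p) : transport h (φ + ψ) = transport h φ + transport h ψ := by
  subst h
  rfl

theorem transport_smul [∀ X Y : D, Preadditive (X ⟶ Y)] [∀ X Y : D, Linear K (X ⟶ Y)]
    {F G : C ⥤ᵖ D} (h : F = G) {p : ℕ} (r : K) (φ : Cochain F p) :
    transport h (r • φ) = r • transport h φ := by
  subst h
  rfl

end

end Cochains

section Gray

/-- The power `B × (B × (⋯ × B))` with `q + 1` factors. -/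
def Power (B : Type u) : ℕ → Type u
  | 0 => B
  | q + 1 => B × Power B q

instance powerBicategory (B : Type u) [h : Bicategory.{w, v} B] :
    ∀ q : ℕ, Bicategory.{w, v} (Power B q)
  | 0 => h
  | q + 1 => @Bicategory.prod B h (Power B q) (powerBicategory B q)

variable {B : Type u} [Bicategory.{w, v} B]

/-- The pseudofunctor `(X, Y, Z) ↦ (X ⊗ Y) ⊗ Z`. -/
def tensorLeft (T : (B × B) ⥤ᵖ B) : (B × (B × B)) ⥤ᵖ B :=
  (pair ((pair (proj₁ B (B × B)) ((proj₂ B (B × B)).comp (proj₁ B B))).comp T)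
    ((proj₂ B (B × B)).comp (proj₂ B B))).comp T

/-- The pseudofunctor `(X, Y, Z) ↦ X ⊗ (Y ⊗ Z)`. -/
def tensorRight (T : (B × B) ⥤ᵖ B) : (B × (B × B)) ⥤ᵖ B :=
  (pair (proj₁ B (B × B)) ((proj₂ B (B × B)).comp T)).comp T

/-- The 2-morphism `σ ⊗ τ : f ⊗ g ⟹ f' ⊗ g'`. -/
def tensorHom₂ (T : (B × B) ⥤ᵖ B) {X X' Y Y' : B} {f f' : X ⟶ X'} {g g' : Y ⟶ Y'}
    (σ : f ⟶ f') (τ : g ⟶ g') : T.map (f ×ₘ g) ⟶ T.map (f' ×ₘ g') :=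
  T.map₂ ((σ, τ) : (f ×ₘ g) ⟶ (f' ×ₘ g'))

/-- A `K`-linear Gray semigroup structure on a `K`-linear 2-category `B`: a `K`-bilinear cubical
pseudofunctor `⊗ : B × B ⥤ᵖ B` that is strictly associative. -/
structure GraySemigroup (K : Type*) [CommRing K] (B : Type u) [Bicategory.{w, v} B]
    [∀ X Y : B, Preadditive (X ⟶ Y)] [∀ X Y : B, Linear K (X ⟶ Y)] where
  /-- The tensor product. -/
  tensor : (B × B) ⥤ᵖ B
  /-- The tensor product preserves identity 1-morphisms strictly. -/
  mapId_eq : ∀ X : B × B, ∃ h, tensor.mapId X = eqToIso h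
  /-- `(f' ⊗ 1) ∘ (f ⊗ g) ≅ (f' ∘ f) ⊗ g` is the identity. -/
  mapComp_id_right : ∀ {X X' X'' Y Y' : B} (f : X ⟶ X') (f' : X' ⟶ X'') (g : Y ⟶ Y'),
    ∃ h, tensor.mapComp (f ×ₘ g) (f' ×ₘ 𝟙 Y') = eqToIso h
  /-- `(f ⊗ g') ∘ (1 ⊗ g) ≅ f ⊗ (g' ∘ g)` is the identity. -/
  mapComp_id_left : ∀ {X X' Y Y' Y'' : B} (f : X ⟶ X') (g : Y ⟶ Y') (g' : Y' ⟶ Y''),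
    ∃ h, tensor.mapComp (𝟙 X ×ₘ g) (f ×ₘ g') = eqToIso h
  /-- The tensor product is strictly associative, as a pseudofunctor. -/
  assoc : tensorLeft tensor = tensorRight tensor
  add_tensor : ∀ {X X' Y Y' : B} {f f' : X ⟶ X'} {g g' : Y ⟶ Y'} (σ σ' : f ⟶ f') (τ : g ⟶ g'),
    tensorHom₂ tensor (σ + σ') τ = tensorHom₂ tensor σ τ + tensorHom₂ tensor σ' τ
  tensor_add : ∀ {X X' Y Y' : B} {f f' : X ⟶ X'} {g g' : Y ⟶ Y'} (σ : f ⟶ f') (τ τ' : g ⟶ g'),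
    tensorHom₂ tensor σ (τ + τ') = tensorHom₂ tensor σ τ + tensorHom₂ tensor σ τ'
  smul_tensor : ∀ {X X' Y Y' : B} {f f' : X ⟶ X'} {g g' : Y ⟶ Y'} (r : K) (σ : f ⟶ f')
    (τ : g ⟶ g'), tensorHom₂ tensor (r • σ) τ = r • tensorHom₂ tensor σ τ
  tensor_smul : ∀ {X X' Y Y' : B} {f f' : X ⟶ X'} {g g' : Y ⟶ Y'} (r : K) (σ : f ⟶ f')
    (τ : g ⟶ g'), tensorHom₂ tensor σ (r • τ) = r • tensorHom₂ tensor σ τ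

namespace GraySemigroup

variable {K : Type*} [CommRing K] [∀ X Y : B, Preadditive (X ⟶ Y)]
  [∀ X Y : B, Linear K (X ⟶ Y)] (G : GraySemigroup K B)

/-- The iterated tensor product `(X₁, …, X_n) ↦ X₁ ⊗ (X₂ ⊗ (⋯ ⊗ X_n))` of `n = q + 1` variables. -/
def tens : ∀ q : ℕ, Power B q ⥤ᵖ B
  | 0 => Pseudofunctor.id B
  | q + 1 => (pair (proj₁ B (Power B q)) ((proj₂ B (Power B q)).comp (tens q))).comp G.tensor

/-- The pseudofunctor that tensors two adjacent variables: for `i ≤ q`,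
`(X₀, …, X_{q+1}) ↦ (X₀, …, X_i ⊗ X_{i+1}, …, X_{q+1})`. -/
def face : ∀ (q : ℕ) (_ : ℕ), Power B (q + 1) ⥤ᵖ Power B q
  | 0, _ => G.tensor
  | q + 1, 0 =>
    pair ((pair (proj₁ B (B × Power B q))
      ((proj₂ B (B × Power B q)).comp (proj₁ B (Power B q)))).comp G.tensor)
      ((proj₂ B (B × Power B q)).comp (proj₂ B (Power B q)))
  | q + 1, i + 1 => pair (proj₁ B (Power B (q + 1))) ((proj₂ B (Power B (q + 1))).comp (face q i))

variable (B) in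
/-- The projection `(X₀, …, X_{q+1}) ↦ (X₀, …, X_q)`. -/
def front : ∀ q : ℕ, Power B (q + 1) ⥤ᵖ Power B q
  | 0 => proj₁ B B
  | q + 1 => pair (proj₁ B (Power B (q + 1))) ((proj₂ B (Power B (q + 1))).comp (front q))

variable (B) in
/-- The projection `(X₀, …, X_{q+1}) ↦ X_{q+1}`. -/
def last : ∀ q : ℕ, Power B (q + 1) ⥤ᵖ B
  | 0 => proj₂ B B
  | q + 1 => (proj₂ B (Power B (q + 1))).comp (last q)

theorem assoc_comp {P : Type u₁} [Bicategory.{w₁, v₁} P]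
    (x y z : P ⥤ᵖ B) :
    (pair ((pair x y).comp G.tensor) z).comp G.tensor =
      (pair x ((pair y z).comp G.tensor)).comp G.tensor := by
  have h := congrArg (fun T => (pair x (pair y z)).comp T) G.assoc
  simpa only [tensorLeft, tensorRight, ← comp_assoc, comp_pair, pair_proj₁, pair_proj₂] using h

theorem face_comp_tens : ∀ q i : ℕ, (G.face q i).comp (G.tens q) = G.tens (q + 1)
  | 0, i => by
    change G.tensor.comp (Pseudofunctor.id B) =
      (pair (proj₁ B B) ((proj₂ B B).comp (Pseudofunctor.id B))).comp G.tensor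
    rw [comp_id, comp_id, pair_proj, id_comp]
  | q + 1, 0 => by
    let π₁ := proj₁ B (B × Power B q)
    let π₂ := proj₂ B (B × Power B q)
    let ρ₁ := proj₁ B (Power B q)
    let ρ₂ := proj₂ B (Power B q)
    change (pair ((pair π₁ (π₂.comp ρ₁)).comp G.tensor) (π₂.comp ρ₂)).comp
        ((pair ρ₁ (ρ₂.comp (G.tens q))).comp G.tensor) =
      (pair π₁ (π₂.comp ((pair ρ₁ (ρ₂.comp (G.tens q))).comp G.tensor))).comp G.tensor
    simp only [← comp_assoc, comp_pair]
    rw [pair_proj₁, pair_proj₂, assoc_comp]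
  | q + 1, i + 1 => by
    let π₁ := proj₁ B (Power B (q + 1))
    let π₂ := proj₂ B (Power B (q + 1))
    change (pair π₁ (π₂.comp (G.face q i))).comp
        ((pair (proj₁ B (Power B q)) ((proj₂ B (Power B q)).comp (G.tens q))).comp G.tensor) =
      (pair π₁ (π₂.comp (G.tens (q + 1)))).comp G.tensor
    rw [← face_comp_tens q i, ← comp_assoc, comp_pair, pair_proj₁, ← comp_assoc, pair_proj₂,
      comp_assoc]

theorem front_tensor_last : ∀ q : ℕ,
    (pair ((front B q).comp (G.tens q)) (last B q)).comp G.tensor = G.tens (q + 1)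
  | 0 => by
    change (pair ((proj₁ B B).comp (Pseudofunctor.id B)) (proj₂ B B)).comp G.tensor =
      (pair (proj₁ B B) ((proj₂ B B).comp (Pseudofunctor.id B))).comp G.tensor
    rw [comp_id, comp_id]
  | q + 1 => by
    let π₁ := proj₁ B (Power B (q + 1))
    let π₂ := proj₂ B (Power B (q + 1))
    change (pair ((pair π₁ (π₂.comp (front B q))).comp
        ((pair (proj₁ B (Power B q)) ((proj₂ B (Power B q)).comp (G.tens q))).comp G.tensor))
        (π₂.comp (last B q))).comp G.tensor =
      (pair π₁ (π₂.comp (G.tens (q + 1)))).comp G.tensor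
    rw [← front_tensor_last q, ← comp_assoc, comp_pair, pair_proj₁, ← comp_assoc, pair_proj₂,
      assoc_comp, ← comp_assoc, comp_pair, comp_assoc]

section

variable {C : Type u₁} [Bicategory.{w₁, v₁} C]

theorem tensorCochain_add (P Q : C ⥤ᵖ B) {p : ℕ} (α : Cochain P p) (β β' : Cochain Q p) :
    tensorCochain G.tensor P Q α (β + β') =
      tensorCochain G.tensor P Q α β + tensorCochain G.tensor P Q α β' := by
  funext X Z s
  ext c
  exact (congrArg (_ ≫ ·) (G.tensor_add _ _ _)).trans (Preadditive.comp_add _ _ _ _ _ _)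

theorem add_tensorCochain (P Q : C ⥤ᵖ B) {p : ℕ} (α α' : Cochain P p) (β : Cochain Q p) :
    tensorCochain G.tensor P Q (α + α') β =
      tensorCochain G.tensor P Q α β + tensorCochain G.tensor P Q α' β := by
  funext X Z s
  ext c
  exact (congrArg (_ ≫ ·) (G.add_tensor _ _ _)).trans (Preadditive.comp_add _ _ _ _ _ _)

theorem tensorCochain_smul (P Q : C ⥤ᵖ B) {p : ℕ} (r : K) (α : Cochain P p) (β : Cochain Q p) :
    tensorCochain G.tensor P Q α (r • β) = r • tensorCochain G.tensor P Q α β := by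
  funext X Z s
  ext c
  exact (congrArg (_ ≫ ·) (G.tensor_smul _ _ _)).trans (Linear.comp_smul _ _ _ _ _ _)

theorem smul_tensorCochain (P Q : C ⥤ᵖ B) {p : ℕ} (r : K) (α : Cochain P p) (β : Cochain Q p) :
    tensorCochain G.tensor P Q (r • α) β = r • tensorCochain G.tensor P Q α β := by
  funext X Z s
  ext c
  exact (congrArg (_ ≫ ·) (G.smul_tensor _ _ _)).trans (Linear.comp_smul _ _ _ _ _ _)

end

/-- The term `⌈1 ⊗ φ⌉` of the vertical coboundary, where `1` stands for
`1_{f⁰_0 ∘ ⋯ ∘ f⁰_p}`. -/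
def colFirst {p q : ℕ} (φ : Cochain (G.tens q) p) : Cochain (G.tens (q + 1)) p :=
  tensorCochain G.tensor (proj₁ B (Power B q)) ((proj₂ B (Power B q)).comp (G.tens q))
    (canonical (proj₁ B (Power B q)) p) (pullback (proj₂ B (Power B q)) (G.tens q) φ)

/-- The term `⌈φ(…, fⁱ ⊗ fⁱ⁺¹, …)⌉` of the vertical coboundary, where `i ≤ q`. -/
def colMiddle {p q : ℕ} (i : ℕ) (φ : Cochain (G.tens q) p) : Cochain (G.tens (q + 1)) p :=
  transport (G.face_comp_tens q i) (pullback (G.face q i) (G.tens q) φ)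

/-- The term `⌈φ ⊗ 1⌉` of the vertical coboundary, where `1` stands for the identity of the
composite of the 1-morphisms in the last variable. -/
def colLast {p q : ℕ} (φ : Cochain (G.tens q) p) : Cochain (G.tens (q + 1)) p :=
  transport (G.front_tensor_last q)
    (tensorCochain G.tensor ((front B q).comp (G.tens q)) (last B q)
      (pullback (front B q) (G.tens q) φ) (canonical (last B q) p))

theorem colFirst_add {p q : ℕ} (φ ψ : Cochain (G.tens q) p) :
    G.colFirst (φ + ψ) = G.colFirst φ + G.colFirst ψ := by
  unfold colFirst
  rw [pullback_add]
  exact G.tensorCochain_add _ _ _ _ _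

theorem colFirst_smul {p q : ℕ} (r : K) (φ : Cochain (G.tens q) p) :
    G.colFirst (r • φ) = r • G.colFirst φ := by
  unfold colFirst
  rw [pullback_smul]
  exact G.tensorCochain_smul _ _ _ _ _

theorem colMiddle_add {p q : ℕ} (i : ℕ) (φ ψ : Cochain (G.tens q) p) :
    G.colMiddle i (φ + ψ) = G.colMiddle i φ + G.colMiddle i ψ := by
  rw [colMiddle, pullback_add, transport_add, colMiddle, colMiddle]

theorem colMiddle_smul {p q : ℕ} (i : ℕ) (r : K) (φ : Cochain (G.tens q) p) :
    G.colMiddle i (r • φ) = r • G.colMiddle i φ := by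
  rw [colMiddle, pullback_smul, transport_smul, colMiddle]

theorem colLast_add {p q : ℕ} (φ ψ : Cochain (G.tens q) p) :
    G.colLast (φ + ψ) = G.colLast φ + G.colLast ψ := by
  rw [colLast, pullback_add, G.add_tensorCochain, transport_add, colLast, colLast]

theorem colLast_smul {p q : ℕ} (r : K) (φ : Cochain (G.tens q) p) :
    G.colLast (r • φ) = r • G.colLast φ := by
  rw [colLast, pullback_smul, G.smul_tensorCochain, transport_smul, colLast]

/-- The component `X^{p,q}` of the double complex: with `m = p + 1` and `n = q + 1`, it is
`X^m(⊗(n))`. -/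
abbrev X (p q : ℕ) : Type _ := Cochain (G.tens q) p

/-- The horizontal coboundary `X^{p,q} ⟶ X^{p+1,q}`. -/
def δh [IsLinear K B] (p q : ℕ) : G.X p q →ₗ[K] G.X (p + 1) q := rowCoboundary K (G.tens q) p

/-- The vertical coboundary `X^{p,q} ⟶ X^{p,q+1}`. -/
def δv (p q : ℕ) : G.X p q →ₗ[K] G.X p (q + 1) where
  toFun φ := G.colFirst φ +
    ∑ i ∈ Finset.range (q + 1), (-1 : K) ^ (i + 1) • G.colMiddle i φ +
      (-1 : K) ^ (q + 2) • G.colLast φ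
  map_add' φ ψ := by
    simp only [colFirst_add, colMiddle_add, colLast_add, smul_add, Finset.sum_add_distrib]
    abel
  map_smul' r φ := by
    simp only [colFirst_smul, colMiddle_smul, colLast_smul, smul_add,
      Finset.smul_sum, RingHom.id_apply, smul_comm r]

end GraySemigroup
end Gray
end GrayComplex

/-! The structural 2-isomorphisms of a pseudofunctor F compose to an invertible canonical 2-morphism
`Str.coh` : F(f₀) ∘ ⋯ ∘ F(f_p) ⟹ F(f₀ ∘ ⋯ ∘ f_p). Dividing a cochain φ by it gives endomorphisms
`hat φ` of F(f₀ ∘ ⋯ ∘ f_p), which determine φ (`hat_ext`). All padding 2-morphisms are compatible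
with `coh`, so in terms of hats the padding becomes conjugation. The first and last cofaces whisker
a hat with F of an outer 1-morphism, a middle coface evaluates at the string with two neighbours
composed, a pullback evaluates at the image string, and a tensor product applies ⊗ to a pair of
hats.

Both differentials are alternating sums of cofaces, so the theorem reduces to identities between
cofaces. Each differential squares to zero by the cosimplicial identities dʲdⁱ = dⁱdʲ⁻¹ for i < j
(`alternating_comp_alternating`). In the rows these follow from strict associativity of composition
in the powers of B and the coherence of F. In the columns they follow from strict associativity of ⊗
(`TotalCochain.tensor_assoc`) and from identities between the pseudofunctors that tensor adjacent
variables or drop variables at the ends.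

The differentials commute because every row coface commutes with every column coface: column cofaces
are built from canonical cochains, pullbacks, tensor products and transports, and row cofaces
respect each of these. The delicate case is `middleCoface_pullback`, where G(f) ∘ G(g) has to be
replaced by G(f ∘ g) in one entry of a string; there the naturality of cochains enters. -/

namespace GrayComplex

/-! ### Compatibility of the padding with the canonical 2-morphisms. -/

section Coherence

variable {C : Type u} [Bicategory.{w, v} C] {D : Type u₁} [Bicategory.{w₁, v₁} D]
  {E : Type u₂} [Bicategory.{w₂, v₂} E]

theorem map₂_associator_inv_eq (F : C ⥤ᵖ D) {W X Y Z : C} (l : W ⟶ X) (f : X ⟶ Y) (g : Y ⟶ Z) :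
    F.map₂ (α_ l f g).inv = (F.mapComp l (f ≫ g)).hom ≫ F.map l ◁ (F.mapComp f g).hom ≫
      (α_ (F.map l) (F.map f) (F.map g)).inv ≫ (F.mapComp l f).inv ▷ F.map g ≫
        (F.mapComp (l ≫ f) g).inv := by
  rw [← cancel_mono (F.map₂ (α_ l f g).hom), ← F.map₂_comp, F.map₂_associator]
  simp

/-- This lemma and the four that follow are the inductive steps of the compatibility of `Str.coh`
with padding, freed from strings: `k` or `n` stands for a composite of images, `θ`, `κ` or `σ` for a
canonical 2-morphism out of it. -/
theorem mapComp_inv_associator_inv (F : C ⥤ᵖ D) {W X Y Z : C} (l : W ⟶ X) (f : X ⟶ Y) (g : Y ⟶ Z)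
    {k : F.obj W ⟶ F.obj X} (θ : k ⟶ F.map l) :
    ((α_ k (F.map f) (F.map g)).hom ≫ k ◁ (F.mapComp f g).inv) ≫
      (θ ▷ F.map (f ≫ g) ≫ (F.mapComp l (f ≫ g)).inv) ≫ F.map₂ (α_ l f g).inv =
    (θ ▷ F.map f ≫ (F.mapComp l f).inv) ▷ F.map g ≫ (F.mapComp (l ≫ f) g).inv := by
  simp only [Category.assoc, comp_whiskerRight]
  rw [map₂_associator_inv_eq, whisker_exchange_assoc]
  simp

theorem mapComp_inv_whiskerRight (F : C ⥤ᵖ D) {X Y Z : C} {l l' : X ⟶ Y} (g : Y ⟶ Z)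
    {k k' : F.obj X ⟶ F.obj Y} (σ : k ⟶ k') (θ' : k' ⟶ F.map l') (τ : l' ⟶ l) (θ : k ⟶ F.map l)
    (h : σ ≫ θ' ≫ F.map₂ τ = θ) :
    σ ▷ F.map g ≫ (θ' ▷ F.map g ≫ (F.mapComp l' g).inv) ≫ F.map₂ (τ ▷ g) =
      θ ▷ F.map g ≫ (F.mapComp l g).inv := by
  subst h
  simp

theorem mapComp_inv_split (F : C ⥤ᵖ D) {W X Y Z : C} (f : W ⟶ X) (l : X ⟶ Y) (m : W ⟶ Y)
    (g : Y ⟶ Z) {k : F.obj X ⟶ F.obj Y} {n : F.obj W ⟶ F.obj Y} (σ : n ⟶ F.map f ≫ k)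
    (κ : k ⟶ F.map l) (τ : f ≫ l ⟶ m) (θ : n ⟶ F.map m)
    (h : σ ≫ F.map f ◁ κ ≫ (F.mapComp f l).inv ≫ F.map₂ τ = θ) :
    (σ ▷ F.map g ≫ (α_ (F.map f) k (F.map g)).hom) ≫
      F.map f ◁ (κ ▷ F.map g ≫ (F.mapComp l g).inv) ≫ (F.mapComp f (l ≫ g)).inv ≫
        F.map₂ ((α_ f l g).inv ≫ τ ▷ g) =
      θ ▷ F.map g ≫ (F.mapComp m g).inv := by
  subst h
  simp [map₂_associator_inv_eq]

theorem mapComp_inv_map₂ (F : C ⥤ᵖ D) {X Y Z : C} {k l : X ⟶ Y} (g : Y ⟶ Z) {m : X ⟶ Z}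
    {n : F.obj X ⟶ F.obj Y} (σ : n ⟶ F.map k) (θ : k ⟶ l) (μ : l ≫ g ⟶ m)
    {ρ : n ⟶ F.map l} (h : σ ≫ F.map₂ θ = ρ) :
    (σ ▷ F.map g ≫ (F.mapComp k g).inv) ≫ F.map₂ (θ ▷ g ≫ μ) =
      ρ ▷ F.map g ≫ (F.mapComp l g).inv ≫ F.map₂ μ := by
  subst h
  simp

theorem comp_mapComp_inv_map₂ (F : C ⥤ᵖ D) {X Y Z : C} {k l : X ⟶ Y} (g : Y ⟶ Z) {m : X ⟶ Z}
    {j n : F.obj X ⟶ F.obj Y} (η : j ⟶ n) (σ : n ⟶ F.map k) (θ : k ⟶ l) (μ : l ≫ g ⟶ m)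
    {ρ : j ⟶ F.map l} (h : η ≫ σ ≫ F.map₂ θ = ρ) :
    η ▷ F.map g ≫ (σ ▷ F.map g ≫ (F.mapComp k g).inv) ≫ F.map₂ (θ ▷ g ≫ μ) =
      ρ ▷ F.map g ≫ (F.mapComp l g).inv ≫ F.map₂ μ := by
  subst h
  simp

theorem isIso_whiskerRight_mapComp_inv (F : C ⥤ᵖ D) {X Y Z : C} (l : X ⟶ Y) (g : Y ⟶ Z)
    {k : F.obj X ⟶ F.obj Y} (θ : k ⟶ F.map l) [IsIso θ] :
    IsIso (θ ▷ F.map g ≫ (F.mapComp l g).inv) := inferInstance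

namespace Str

instance isIso_coh_app (F : C ⥤ᵖ D) :
    ∀ {p : ℕ} {X Z : C} (s : Str C p X Z) (c : s.Chain), IsIso ((s.coh F).app c)
  | _, _, _, .nil _ _, _ => inferInstanceAs (IsIso (𝟙 _))
  | _, _, _, .cons s _, c => by
    have := isIso_coh_app F s c.2
    exact @isIso_whiskerRight_mapComp_inv _ _ _ _ F _ _ _ _ _ _ ((s.coh F).app c.2) this

/-- Coherence: padding the canonical 2-morphism of the shorter string gives that of the longer one.
The analogues below for splitting, pairing and composition of pseudofunctors serve the same end,
namely to turn each padding operator into conjugation of hats. -/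
theorem mergeSource_coh (F : C ⥤ᵖ D) : ∀ {p : ℕ} {X Z : C} (s : Str C (p + 1) X Z) (i : ℕ)
    (c : s.Chain), (s.mergeSource F i).app c ≫ ((s.erase i).coh F).app ((s.merge i).obj c) ≫
      F.map₂ ((s.mergeTarget i).app c) = (s.coh F).app c
  | _, _, _, .cons (.nil X Y) Z, _, c => by
    change (F.mapComp c.2 c.1).inv ≫ 𝟙 _ ≫ F.map₂ (𝟙 _) = 𝟙 _ ▷ F.map c.1 ≫ (F.mapComp c.2 c.1).inv
    simp
  | _, _, _, .cons (.cons s Y) Z, 0, c =>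
    mapComp_inv_associator_inv F (s.comp.obj c.2.2) c.2.1 c.1 ((s.coh F).app c.2.2)
  | _, _, _, .cons (.cons s Y) Z, i + 1, c =>
    mapComp_inv_whiskerRight F c.1 _ _ _ _ (mergeSource_coh F (.cons s Y) i c.2)

theorem splitSource_coh (F : C ⥤ᵖ D) : ∀ {p : ℕ} {X Z : C} (s : Str C (p + 1) X Z)
    (c : s.Chain), (s.splitSource F).app c ≫
      F.map (s.firstMor.obj c) ◁ (s.tail.coh F).app (s.tailChain.obj c) ≫
        (F.mapComp (s.firstMor.obj c) (s.tail.comp.obj (s.tailChain.obj c))).inv ≫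
          F.map₂ (s.splitTarget.app c) = (s.coh F).app c
  | _, _, _, .cons (.nil X Y) Z, c => by
    change 𝟙 _ ≫ F.map c.2 ◁ 𝟙 _ ≫ (F.mapComp c.2 c.1).inv ≫ F.map₂ (𝟙 _) =
      𝟙 _ ▷ F.map c.1 ≫ (F.mapComp c.2 c.1).inv
    simp
  | _, _, _, .cons (.cons s Y) Z, c =>
    mapComp_inv_split F _ _ _ c.1 _ _ _ _ (splitSource_coh F (.cons s Y) c.2)

theorem pairSource_coh {A : Type u₃} [Bicategory.{w₃, v₃} A] (T : (A × D) ⥤ᵖ E) (G : C ⥤ᵖ A)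
    (F : C ⥤ᵖ D) : ∀ {p : ℕ} {X Z : C} (s : Str C p X Z) (c : s.Chain),
      (s.pairSource T G F).app c ≫ T.map₂ ((s.coh G).app c ×ₘ (s.coh F).app c) =
        (s.coh ((pair G F).comp T)).app c
  | _, _, _, .nil _ _, _ => (Category.id_comp _).trans (T.map₂_id _)
  | _, _, _, .cons s Z, c =>
    mapComp_inv_map₂ T ((pair G F).map c.1) ((s.pairSource T G F).app c.2)
      ((s.coh G).app c.2 ×ₘ (s.coh F).app c.2) ((pair G F).mapComp (s.comp.obj c.2) c.1).inv
      (pairSource_coh T G F s c.2)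

theorem compMap_comp_coh (G : C ⥤ᵖ D) (F : D ⥤ᵖ E) :
    ∀ {p : ℕ} {X Z : C} (s : Str C p X Z) (c : s.Chain),
      (eqToHom (s.compMap_comp G F)).app c ≫ ((s.map G.obj).coh F).app ((s.mapChain G).obj c) ≫
        F.map₂ ((s.coh G).app c) = (s.coh (G.comp F)).app c
  | _, _, _, .nil _ _, _ => (Category.id_comp _).trans ((Category.id_comp _).trans (F.map₂_id _))
  | _, _, _, .cons s Z, c => by
    have h := compMap_comp_coh G F s c.2
    -- At each chain the equality of functors is an equality of 1-morphisms, and the one for the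
    -- longer string is obtained from the shorter one by composing with F(G(f₀)).
    have e : (eqToHom ((Str.cons s Z).compMap_comp G F)).app c =
        (eqToHom (s.compMap_comp G F)).app c.2 ▷ F.map (G.map c.1) := by
      refine (eqToHom_app _ _).trans (Eq.trans ?_
        (congrArg (· ▷ F.map (G.map c.1)) (eqToHom_app (s.compMap_comp G F) c.2).symm))
      exact (eqToHom_whiskerRight _ _).symm
    refine (congrArg (· ≫ _) e).trans ?_
    exact comp_mapComp_inv_map₂ F (G.map c.1) _ _ _ _ h

end Str
end Coherence
-- Cochains divided by the canonical 2-morphism.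
section NormalizedComponents

variable {C : Type u} [Bicategory.{w, v} C] {D : Type u₁} [Bicategory.{w₁, v₁} D]
  {E : Type u₂} [Bicategory.{w₂, v₂} E]

/-- Removes the padding. Here `j` is the source padding followed by the old canonical 2-morphism,
`t` the target padding, `k` the new canonical 2-morphism, and `h'`, `h` are the old and new hats.
Since `j` is invertible along with `k` and `t`, it cancels, and only conjugation by `t` remains. -/
theorem comp_eq_comp_of_factor {A : Type*} [Category A] {a b c : A} {j : a ⟶ b} {t : b ⟶ c}
    {k : a ⟶ c} {h' : b ⟶ b} {h : c ⟶ c} (hk : IsIso k) (_ : IsIso t) (e : j ≫ t = k)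
    (e' : k ≫ h = j ≫ h' ≫ t) : h' ≫ t = t ≫ h := by
  subst e
  have : IsIso j := IsIso.of_isIso_comp_right j t
  rw [Category.assoc, cancel_epi] at e'
  exact e'.symm

namespace Str

/-- A component of `Str.coh`. -/
def cohApp (F : C ⥤ᵖ D) {p : ℕ} {X Z : C} (s : Str C p X Z) (c : s.Chain) :
    (s.compMap F).obj c ⟶ F.map (s.comp.obj c) :=
  (s.coh F).app c

/-- A component of `Str.mergeTarget`. -/
def mergeTargetApp {p : ℕ} {X Z : C} (s : Str C (p + 1) X Z) (i : ℕ) (c : s.Chain) :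
    (s.erase i).comp.obj ((s.merge i).obj c) ⟶ s.comp.obj c :=
  (s.mergeTarget i).app c

/-- A component of `Str.splitTarget`. -/
def splitTargetApp {p : ℕ} {X Z : C} (s : Str C (p + 1) X Z) (c : s.Chain) :
    s.firstMor.obj c ≫ s.tail.comp.obj (s.tailChain.obj c) ⟶ s.comp.obj c :=
  s.splitTarget.app c

instance isIso_cohApp (F : C ⥤ᵖ D) {p : ℕ} {X Z : C} (s : Str C p X Z) (c : s.Chain) :
    IsIso (s.cohApp F c) := isIso_coh_app F s c

instance isIso_mergeTargetApp : ∀ {p : ℕ} {X Z : C} (s : Str C (p + 1) X Z) (i : ℕ)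
    (c : s.Chain), IsIso (s.mergeTargetApp i c)
  | _, _, _, .cons (.nil _ _) _, _, _ => inferInstanceAs (IsIso (𝟙 _))
  | _, _, _, .cons (.cons _ _) _, 0, _ => inferInstanceAs (IsIso (α_ _ _ _).inv)
  | _, _, _, .cons (.cons s Y) _, i + 1, c => by
    have := isIso_mergeTargetApp (.cons s Y) i c.2
    exact inferInstanceAs (IsIso ((Str.cons s Y).mergeTargetApp i c.2 ▷ c.1))

instance isIso_splitTargetApp : ∀ {p : ℕ} {X Z : C} (s : Str C (p + 1) X Z) (c : s.Chain),
    IsIso (s.splitTargetApp c)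
  | _, _, _, .cons (.nil _ _) _, _ => inferInstanceAs (IsIso (𝟙 _))
  | _, _, _, .cons (.cons s Y) _, c => by
    have := isIso_splitTargetApp (.cons s Y) c.2
    exact inferInstanceAs (IsIso ((α_ ((Str.cons s Y).firstMor.obj c.2)
      ((Str.cons s Y).tail.comp.obj ((Str.cons s Y).tailChain.obj c.2)) c.1).inv ≫
        (Str.cons s Y).splitTargetApp c.2 ▷ c.1))

end Str

/-- The component of a cochain at a chain. -/
def Cochain.app {F : C ⥤ᵖ D} {p : ℕ} (φ : Cochain F p) {X Z : C} (s : Str C p X Z) (c : s.Chain) :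
    (s.compMap F).obj c ⟶ F.map (s.comp.obj c) :=
  (φ X Z s).app c

/-- The endomorphism of `F(f₀ ∘ ⋯ ∘ f_p)` obtained from a component of a cochain of `F` by
inverting the canonical 2-morphism. -/
noncomputable def hatAt {F : C ⥤ᵖ D} {p : ℕ} (φ : Cochain F p) {X Z : C} (s : Str C p X Z) (c : s.Chain) :
    F.map (s.comp.obj c) ⟶ F.map (s.comp.obj c) :=
  inv (s.cohApp F c) ≫ Cochain.app φ s c

theorem coh_hatAt {F : C ⥤ᵖ D} {p : ℕ} (φ : Cochain F p) {X Z : C} (s : Str C p X Z)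
    (c : s.Chain) : s.cohApp F c ≫ hatAt φ s c = Cochain.app φ s c :=
  IsIso.hom_inv_id_assoc _ _

theorem hatAt_naturality {F : C ⥤ᵖ D} {p : ℕ} (φ : Cochain F p) {X Z : C} (s : Str C p X Z)
    {c c' : s.Chain} (τ : c ⟶ c') :
    hatAt φ s c ≫ F.map₂ (s.comp.map τ) = F.map₂ (s.comp.map τ) ≫ hatAt φ s c' := by
  have h : (s.compMap F).map τ ≫ Cochain.app φ s c' =
    Cochain.app φ s c ≫ F.map₂ (s.comp.map τ) := (φ X Z s).naturality τ
  have h' : (s.compMap F).map τ ≫ s.cohApp F c' =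
    s.cohApp F c ≫ F.map₂ (s.comp.map τ) := (s.coh F).naturality τ
  rw [← coh_hatAt, ← coh_hatAt, reassoc_of% h', Category.assoc, cancel_epi] at h
  exact h.symm

theorem hatAt_canonical (F : C ⥤ᵖ D) {p : ℕ} {X Z : C} (s : Str C p X Z) (c : s.Chain) :
    hatAt (canonical F p) s c = 𝟙 _ :=
  IsIso.inv_hom_id (s.cohApp F c)

theorem hatAt_rowFirst {F : C ⥤ᵖ D} {p : ℕ} (φ : Cochain F p) {X Y : C} (s : Str C p X Y) (Z : C)
    (c : s.Chain) (f : Y ⟶ Z) :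
    hatAt (p := p + 1) (fun _ _ s => rowFirst F φ s) (.cons s Z) (f, c) =
      (F.mapComp (s.comp.obj c) f).hom ≫ hatAt φ s c ▷ F.map f ≫
        (F.mapComp (s.comp.obj c) f).inv := by
  have := (Str.cons s Z).isIso_cohApp F (f, c)
  refine (cancel_epi ((Str.cons s Z).cohApp F (f, c))).1 ((coh_hatAt _ _ _).trans ?_)
  change Cochain.app φ s c ▷ F.map f ≫ (F.mapComp (s.comp.obj c) f).inv =
    (s.cohApp F c ▷ F.map f ≫ (F.mapComp (s.comp.obj c) f).inv) ≫ _
  rw [← coh_hatAt]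
  simp

/-- Written as commutation with the target padding, which spares an inverse and composes well with
further squares. The last coface, the pullback and their versions for paths have the same form. -/
theorem hatAt_rowMiddle {F : C ⥤ᵖ D} {p : ℕ} (i : ℕ) (φ : Cochain F p) {X Z : C}
    (s : Str C (p + 1) X Z) (c : s.Chain) :
    hatAt φ (s.erase i) ((s.merge i).obj c) ≫ F.map₂ (s.mergeTargetApp i c) =
      F.map₂ (s.mergeTargetApp i c) ≫ hatAt (fun _ _ s => rowMiddle F i φ s) s c := by
  refine comp_eq_comp_of_factor (s.isIso_cohApp F c) inferInstance (j := (s.mergeSource F i).app c ≫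
    (s.erase i).cohApp F ((s.merge i).obj c)) (k := s.cohApp F c)
    ((Category.assoc _ _ _).trans (s.mergeSource_coh F i c)) ((coh_hatAt _ _ _).trans ?_)
  change (s.mergeSource F i).app c ≫ Cochain.app φ (s.erase i) ((s.merge i).obj c) ≫
    F.map₂ (s.mergeTargetApp i c) = _
  rw [← coh_hatAt]
  exact ((Category.assoc _ _ _).trans (congrArg (_ ≫ ·) (Category.assoc _ _ _).symm)).symm

theorem hatAt_rowLast {F : C ⥤ᵖ D} {p : ℕ} (φ : Cochain F p) {X Z : C}
    (s : Str C (p + 1) X Z) (c : s.Chain) :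
    (F.map (s.firstMor.obj c) ◁ hatAt φ s.tail (s.tailChain.obj c)) ≫
        (F.mapComp (s.firstMor.obj c) (s.tail.comp.obj (s.tailChain.obj c))).inv ≫
          F.map₂ (s.splitTargetApp c) =
      ((F.mapComp (s.firstMor.obj c) (s.tail.comp.obj (s.tailChain.obj c))).inv ≫
          F.map₂ (s.splitTargetApp c)) ≫ hatAt (fun _ _ s => rowLast F φ s) s c := by
  refine comp_eq_comp_of_factor (s.isIso_cohApp F c) inferInstance (j := (s.splitSource F).app c ≫
    F.map (s.firstMor.obj c) ◁ s.tail.cohApp F (s.tailChain.obj c)) (k := s.cohApp F c)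
    ((Category.assoc _ _ _).trans (s.splitSource_coh F c)) ((coh_hatAt _ _ _).trans ?_)
  change (s.splitSource F).app c ≫
    F.map (s.firstMor.obj c) ◁ Cochain.app φ s.tail (s.tailChain.obj c) ≫
      (F.mapComp (s.firstMor.obj c) (s.tail.comp.obj (s.tailChain.obj c))).inv ≫
        F.map₂ (s.splitTargetApp c) = _
  rw [← coh_hatAt, whiskerLeft_comp]
  exact (congrArg (_ ≫ ·) (Category.assoc _ _ _)).trans (Category.assoc _ _ _).symm

theorem hatAt_pullback (G : C ⥤ᵖ D) {F : D ⥤ᵖ E} {p : ℕ} (φ : Cochain F p) {X Z : C}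
    (s : Str C p X Z) (c : s.Chain) :
    hatAt φ (s.map G.obj) ((s.mapChain G).obj c) ≫ F.map₂ (s.cohApp G c) =
      F.map₂ (s.cohApp G c) ≫ hatAt (pullback G F φ) s c := by
  have : IsIso (F.map₂ (s.cohApp G c)) := inferInstance
  refine comp_eq_comp_of_factor (s.isIso_cohApp (G.comp F) c) this (t := F.map₂ (s.cohApp G c))
    (j := (eqToHom (s.compMap_comp G F)).app c ≫
    (s.map G.obj).cohApp F ((s.mapChain G).obj c)) (k := s.cohApp (G.comp F) c)
    ((Category.assoc _ _ _).trans (s.compMap_comp_coh G F c)) ((coh_hatAt _ _ _).trans ?_)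
  change (eqToHom (s.compMap_comp G F)).app c ≫
    Cochain.app φ (s.map G.obj) ((s.mapChain G).obj c) ≫ F.map₂ (s.cohApp G c) = _
  rw [← coh_hatAt]
  exact ((Category.assoc _ _ _).trans (congrArg (_ ≫ ·) (Category.assoc _ _ _).symm)).symm

theorem hatAt_tensorCochain {A : Type u₃} [Bicategory.{w₃, v₃} A] (T : (A × D) ⥤ᵖ E)
    {G : C ⥤ᵖ A} {F : C ⥤ᵖ D} {p : ℕ} (α : Cochain G p) (β : Cochain F p) {X Z : C}
    (s : Str C p X Z) (c : s.Chain) :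
    hatAt (tensorCochain T G F α β) s c = T.map₂ (hatAt α s c ×ₘ hatAt β s c) := by
  refine (cancel_epi (s.cohApp ((pair G F).comp T) c)).1 ((coh_hatAt _ _ _).trans ?_)
  refine Eq.trans ?_ (congrArg (· ≫ _) (s.pairSource_coh T G F c))
  change (s.pairSource T G F).app c ≫ T.map₂ (Cochain.app α s c ×ₘ Cochain.app β s c) = _
  refine Eq.trans ?_ (Category.assoc _ _ _).symm
  refine congrArg (_ ≫ ·) (Eq.trans ?_ (T.map₂_comp _ _))
  exact congrArg (fun x => T.map₂ x) (Prod.ext (coh_hatAt _ _ _).symm (coh_hatAt _ _ _).symm)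

theorem cochain_ext {F : C ⥤ᵖ D} {p : ℕ} {φ ψ : Cochain F p}
    (h : ∀ {X Z : C} (s : Str C p X Z) (c : s.Chain), hatAt φ s c = hatAt ψ s c) : φ = ψ := by
  funext X Z s
  ext c
  exact (coh_hatAt φ s c).symm.trans ((congrArg _ (h s c)).trans (coh_hatAt ψ s c))

end NormalizedComponents

/-! ### Strings of 1-morphisms as a single inductive type. -/

section Paths

variable (C : Type u) [Bicategory.{w, v} C]

/-- `Path C p X Z` is the type of strings of `p + 1` composable 1-morphisms from `X` to `Z`. -/
inductive Path : ℕ → C → C → Type (max u v)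
  | single {X Z : C} (f : X ⟶ Z) : Path 0 X Z
  | cons {p : ℕ} {X Y Z : C} (x : Path p X Y) (f : Y ⟶ Z) : Path (p + 1) X Z

variable {C} {D : Type u₁} [Bicategory.{w₁, v₁} D] {E : Type u₂} [Bicategory.{w₂, v₂} E]

/-- Add a 1-morphism at the end of a chain. -/
def chainCons {p : ℕ} {X Y Z : C} {s : Str C p X Y} (f : Y ⟶ Z) (c : s.Chain) :
    (Str.cons s Z).Chain := (f, c)

/-- Whisker a 2-morphism out of the composite of a chain with a further 1-morphism. -/
def consApp {p : ℕ} {X Y Z : C} {s : Str C p X Y} {c : s.Chain} {g : X ⟶ Y}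
    (θ : s.comp.obj c ⟶ g) (f : Y ⟶ Z) : (Str.cons s Z).comp.obj (chainCons f c) ⟶ g ≫ f :=
  show s.comp.obj c ≫ f ⟶ g ≫ f from θ ▷ f

namespace Path

/-- The string of objects of a path. -/
def str : ∀ {p : ℕ} {X Z : C}, Path C p X Z → Str C p X Z
  | _, _, _, .single (X := X) (Z := Z) _ => .nil X Z
  | _, _, _, .cons (Z := Z) x _ => .cons x.str Z

/-- The string of 1-morphisms of a path. -/
def chain : ∀ {p : ℕ} {X Z : C} (x : Path C p X Z), x.str.Chain
  | _, _, _, .single f => f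
  | _, _, _, .cons x f => (f, x.chain)

/-- The composite of a path. -/
def comp {p : ℕ} {X Z : C} (x : Path C p X Z) : X ⟶ Z := x.str.comp.obj x.chain

theorem forall_str_chain : ∀ {p : ℕ} {X Z : C} (s : Str C p X Z) (c : s.Chain),
    ∃ x : Path C p X Z, (⟨x.str, x.chain⟩ : Σ s : Str C p X Z, s.Chain) = ⟨s, c⟩
  | _, _, _, .nil _ _, c => ⟨.single c, rfl⟩
  | _, _, _, .cons s Z, c => by
    obtain ⟨x, hx⟩ := forall_str_chain s c.2
    exact ⟨.cons x c.1, congrArg (fun o : Σ s : Str C _ _ _, s.Chain =>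
      (⟨.cons o.1 Z, chainCons (c.1) (o.2)⟩ : Σ s : Str C _ _ _, s.Chain)) hx⟩

/-- Compose two adjacent 1-morphisms of a path: `i = 0` composes the two at the end, and so on. -/
def merge : ∀ {p : ℕ} {X Z : C}, Path C (p + 1) X Z → ℕ → Path C p X Z
  | _, _, _, .cons (.single f) g, _ => .single (f ≫ g)
  | _, _, _, .cons (.cons x f) g, 0 => .cons x (f ≫ g)
  | _, _, _, .cons (.cons x f) g, i + 1 => .cons ((Path.cons x f).merge i) g

/-- The canonical 2-morphism between the composites of a path before and after `Path.merge`. -/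
def mergeTo : ∀ {p : ℕ} {X Z : C} (x : Path C (p + 1) X Z) (i : ℕ), (x.merge i).comp ⟶ x.comp
  | _, _, _, .cons (.single f) g, _ => 𝟙 (f ≫ g)
  | _, _, _, .cons (.cons x f) g, 0 => (α_ x.comp f g).inv
  | _, _, _, .cons (.cons x f) g, i + 1 => (Path.cons x f).mergeTo i ▷ g

/-- Add a 1-morphism at the start of a path. -/
def snoc : ∀ {p : ℕ} {W X Z : C}, (W ⟶ X) → Path C p X Z → Path C (p + 1) W Z
  | _, _, _, _, f, .single g => .cons (.single f) g
  | _, _, _, _, f, .cons x g => .cons (x.snoc f) g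

/-- The canonical 2-morphism from `f ≫ x.comp` to the composite of `x.snoc f`. -/
def snocTo : ∀ {p : ℕ} {W X Z : C} (f : W ⟶ X) (x : Path C p X Z), f ≫ x.comp ⟶ (x.snoc f).comp
  | _, _, _, _, f, .single g => 𝟙 (f ≫ g)
  | _, _, _, _, f, .cons x g => (α_ f x.comp g).inv ≫ x.snocTo f ▷ g

theorem exists_eq_snoc : ∀ {p : ℕ} {W Z : C} (y : Path C (p + 1) W Z),
    ∃ (X : C) (f : W ⟶ X) (x : Path C p X Z), y = x.snoc f
  | _, _, _, .cons (.single f) g => ⟨_, f, .single g, rfl⟩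
  | _, _, _, .cons (.cons x f) g => by
    obtain ⟨X, h, y, e⟩ := exists_eq_snoc (.cons x f)
    exact ⟨X, h, .cons y g, congrArg (fun z => Path.cons z g) e⟩

/-- The strings, the chains over them and the 2-morphisms over the chains agree only
propositionally. Equating the whole dependent tuple lets a single `congrArg` carry a statement about
hats from strings to paths; `mk_snoc`, `IsImage.mk_eq` and `Hom₂.mk_eq` play the same role. -/
theorem mk_merge : ∀ {p : ℕ} {X Z : C} (x : Path C (p + 1) X Z) (i : ℕ),
    (⟨(x.merge i).str, (x.merge i).chain, x.mergeTo i⟩ :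
      Σ (s : Str C p X Z) (c : s.Chain), s.comp.obj c ⟶ x.comp) =
    ⟨x.str.erase i, (x.str.merge i).obj x.chain, x.str.mergeTargetApp i x.chain⟩
  | _, _, _, .cons (.single _) _, _ => rfl
  | _, _, _, .cons (.cons _ _) _, 0 => rfl
  | _, _, Z, .cons (.cons x f) g, i + 1 =>
    congrArg (fun o : Σ (s : Str C _ _ _) (c : s.Chain), s.comp.obj c ⟶ (Path.cons x f).comp =>
      (⟨.cons o.1 Z, chainCons (g) (o.2.1), consApp o.2.2 g⟩ :
        Σ (s : Str C _ _ _) (c : s.Chain), s.comp.obj c ⟶ (Path.cons x f).comp ≫ g))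
      (mk_merge (.cons x f) i)

theorem mk_snoc : ∀ {p : ℕ} {W X Z : C} (f : W ⟶ X) (x : Path C p X Z),
    (⟨X, f, x.str, x.chain, x.snocTo f⟩ :
      Σ (Y : C) (f' : W ⟶ Y) (s : Str C p Y Z) (c : s.Chain),
        f' ≫ s.comp.obj c ⟶ (x.snoc f).comp) =
    ⟨(x.snoc f).str.second, (x.snoc f).str.firstMor.obj (x.snoc f).chain, (x.snoc f).str.tail,
      (x.snoc f).str.tailChain.obj (x.snoc f).chain, (x.snoc f).str.splitTargetApp _⟩
  | _, _, _, _, _, .single _ => rfl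
  | _, _, _, _, _, .cons (.single _) _ => rfl
  | _, W, _, Z, f, .cons (.cons x h) g =>
    congrArg (fun o : Σ (Y : C) (f' : W ⟶ Y) (s : Str C _ Y _) (c : s.Chain),
        f' ≫ s.comp.obj c ⟶ ((Path.cons x h).snoc f).comp =>
      (⟨o.1, o.2.1, .cons o.2.2.1 Z, chainCons (g) (o.2.2.2.1), (α_ _ _ _).inv ≫ o.2.2.2.2 ▷ g⟩ :
        Σ (Y : C) (f' : W ⟶ Y) (s : Str C _ Y _) (c : s.Chain),
        f' ≫ s.comp.obj c ⟶ ((Path.cons (Path.cons x h) g).snoc f).comp))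
      (mk_snoc f (.cons x h))

/-- `IsImage G x y θ` says that `y` is the image of the path `x` under `G` and `θ` is the canonical
2-morphism `G(f₀) ∘ ⋯ ∘ G(f_p) ⟹ G(f₀ ∘ ⋯ ∘ f_p)`. -/
inductive IsImage (G : C ⥤ᵖ D) : ∀ {p : ℕ} {X Z : C} (_ : Path C p X Z)
    (y : Path D p (G.obj X) (G.obj Z)), (y.comp ⟶ G.map (Path.comp ‹_›)) → Prop
  | single {X Z : C} (f : X ⟶ Z) : IsImage G (.single f) (.single (G.map f)) (𝟙 (G.map f))
  | cons {p : ℕ} {X Y Z : C} {x : Path C p X Y} {y : Path D p (G.obj X) (G.obj Y)}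
      {θ : y.comp ⟶ G.map x.comp} (h : IsImage G x y θ) (f : Y ⟶ Z) :
      IsImage G (.cons x f) (.cons y (G.map f)) (θ ▷ G.map f ≫ (G.mapComp x.comp f).inv)

theorem exists_isImage (G : C ⥤ᵖ D) : ∀ {p : ℕ} {X Z : C} (x : Path C p X Z),
    ∃ (y : Path D p (G.obj X) (G.obj Z)) (θ : y.comp ⟶ G.map x.comp), IsImage G x y θ
  | _, _, _, .single f => ⟨_, _, .single f⟩
  | _, _, _, .cons x f => by
    obtain ⟨y, θ, h⟩ := exists_isImage G x
    exact ⟨_, _, h.cons f⟩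

/-- Links the relation `IsImage` to `Str.mapChain` and `Str.cohApp`. The relation generates the
image together with its canonical 2-morphism, so that later inductions meet no casts. -/
theorem IsImage.mk_eq {G : C ⥤ᵖ D} {p : ℕ} {X Z : C} {x : Path C p X Z}
    {y : Path D p (G.obj X) (G.obj Z)} {θ : y.comp ⟶ G.map x.comp} (h : IsImage G x y θ) :
    (⟨y.str, y.chain, θ⟩ : Σ (s : Str D p (G.obj X) (G.obj Z)) (c : s.Chain),
      s.comp.obj c ⟶ G.map x.comp) =
    ⟨x.str.map G.obj, (x.str.mapChain G).obj x.chain, x.str.cohApp G x.chain⟩ := by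
  induction h with
  | single f => rfl
  | @cons p X Y Z x y θ h f ih =>
    exact congrArg (fun o : Σ (s : Str D p (G.obj X) (G.obj Y)) (c : s.Chain),
        s.comp.obj c ⟶ G.map x.comp => (⟨.cons o.1 _, chainCons (G.map f) (o.2.1),
          o.2.2 ▷ G.map f ≫ (G.mapComp x.comp f).inv⟩ :
        Σ (s : Str D (p + 1) (G.obj X) (G.obj Z)) (c : s.Chain),
          s.comp.obj c ⟶ G.map (Path.cons x f).comp)) ih

theorem IsImage.isIso {G : C ⥤ᵖ D} {p : ℕ} {X Z : C} {x : Path C p X Z}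
    {y : Path D p (G.obj X) (G.obj Z)} {θ : y.comp ⟶ G.map x.comp} (h : IsImage G x y θ) :
    IsIso θ := by
  induction h with
  | single f => exact inferInstanceAs (IsIso (𝟙 _))
  | cons h f ih => exact isIso_whiskerRight_mapComp_inv G _ f _

end Path
end Paths
-- Hats at paths and their behaviour under the operations on cochains.
section Hats

variable {C : Type u} [Bicategory.{w, v} C] {D : Type u₁} [Bicategory.{w₁, v₁} D]
  {E : Type u₂} [Bicategory.{w₂, v₂} E]

/-- The coface `φ ↦ ⌈1_{F(f₀)} ∘ φ(f₁, …, f_{p+1})⌉`. -/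
def firstCoface {F : C ⥤ᵖ D} {p : ℕ} (φ : Cochain F p) : Cochain F (p + 1) :=
  fun _ _ s => rowFirst F φ s

/-- The coface `φ ↦ ⌈φ(f₀, …, f_i ∘ f_{i+1}, …, f_{p+1})⌉`. -/
def middleCoface {F : C ⥤ᵖ D} {p : ℕ} (i : ℕ) (φ : Cochain F p) : Cochain F (p + 1) :=
  fun _ _ s => rowMiddle F i φ s

/-- The coface `φ ↦ ⌈φ(f₀, …, f_p) ∘ 1_{F(f_{p+1})}⌉`. -/
def lastCoface {F : C ⥤ᵖ D} {p : ℕ} (φ : Cochain F p) : Cochain F (p + 1) :=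
  fun _ _ s => rowLast F φ s

namespace Path

instance isIso_mergeTo : ∀ {p : ℕ} {X Z : C} (x : Path C (p + 1) X Z) (i : ℕ),
    IsIso (x.mergeTo i)
  | _, _, _, .cons (.single f) g, _ => inferInstanceAs (IsIso (𝟙 (f ≫ g)))
  | _, _, _, .cons (.cons x f) g, 0 => inferInstanceAs (IsIso (α_ x.comp f g).inv)
  | _, _, _, .cons (.cons x f) g, i + 1 => by
    have := isIso_mergeTo (.cons x f) i
    exact inferInstanceAs (IsIso ((Path.cons x f).mergeTo i ▷ g))

instance isIso_snocTo : ∀ {p : ℕ} {W X Z : C} (f : W ⟶ X) (x : Path C p X Z),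
    IsIso (x.snocTo f)
  | _, _, _, _, f, .single g => inferInstanceAs (IsIso (𝟙 (f ≫ g)))
  | _, _, _, _, f, .cons x g => by
    have := isIso_snocTo f x
    exact inferInstanceAs (IsIso ((α_ f x.comp g).inv ≫ x.snocTo f ▷ g))

/-- `Hom₂ x y τ` says that `τ` is the composite of 2-morphisms between the entries of the parallel
paths `x` and `y`. -/
inductive Hom₂ : ∀ {p : ℕ} {X Z : C} (x y : Path C p X Z), (x.comp ⟶ y.comp) → Prop
  | single {X Z : C} {f g : X ⟶ Z} (σ : f ⟶ g) : Hom₂ (.single f) (.single g) σ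
  | cons {p : ℕ} {X Y Z : C} {x y : Path C p X Y} {τ : x.comp ⟶ y.comp} (h : Hom₂ x y τ)
      {f g : Y ⟶ Z} (σ : f ⟶ g) : Hom₂ (.cons x f) (.cons y g) (τ ▷ f ≫ y.comp ◁ σ)

theorem Hom₂.refl : ∀ {p : ℕ} {X Z : C} (x : Path C p X Z), Hom₂ x x (𝟙 x.comp)
  | _, _, _, .single f => .single (𝟙 f)
  | _, _, _, .cons x f => by
    have h := (Hom₂.refl x).cons (𝟙 f)
    have e : 𝟙 x.comp ▷ f ≫ x.comp ◁ 𝟙 f = 𝟙 (Path.cons x f).comp := by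
      rw [id_whiskerRight, whiskerLeft_id, Category.comp_id]
      rfl
    exact e ▸ h

theorem Hom₂.mk_eq {p : ℕ} {X Z : C} {x y : Path C p X Z} {τ : x.comp ⟶ y.comp}
    (h : Hom₂ x y τ) : ∃ (c : x.str.Chain) (t : x.chain ⟶ c),
      (⟨y.str, y.chain, τ⟩ : Σ (s : Str C p X Z) (c : s.Chain), x.comp ⟶ s.comp.obj c) =
        ⟨x.str, c, x.str.comp.map t⟩ := by
  induction h with
  | @single X Z f g σ => exact ⟨g, σ, rfl⟩
  | @cons p X Y Z x y τ h f g σ ih =>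
    obtain ⟨c, t, e⟩ := ih
    refine ⟨(g, c), (show ((f, x.chain) : (Y ⟶ Z) × x.str.Chain) ⟶ (g, c) from (σ, t)), ?_⟩
    exact congrArg (fun o : Σ (s : Str C p X Y) (c : s.Chain), x.comp ⟶ s.comp.obj c =>
      (⟨.cons o.1 Z, chainCons g o.2.1, o.2.2 ▷ f ≫ o.1.comp.obj o.2.1 ◁ σ⟩ :
        Σ (s : Str C (p + 1) X Z) (c : s.Chain), x.comp ≫ f ⟶ s.comp.obj c)) e

end Path

/-- The component `hatAt` at a path. -/
noncomputable def hat {F : C ⥤ᵖ D} {p : ℕ} (φ : Cochain F p) {X Z : C} (x : Path C p X Z) :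
    F.map x.comp ⟶ F.map x.comp :=
  hatAt φ x.str x.chain

theorem hat_ext {F : C ⥤ᵖ D} {p : ℕ} {φ ψ : Cochain F p}
    (h : ∀ {X Z : C} (x : Path C p X Z), hat φ x = hat ψ x) : φ = ψ := by
  refine cochain_ext fun {X Z} s c => ?_
  obtain ⟨x, e⟩ := Path.forall_str_chain s c
  exact (congrArg (fun o : Σ s : Str C p X Z, s.Chain => hatAt φ o.1 o.2 = hatAt ψ o.1 o.2) e).mp
    (h x)

theorem hat_canonical (F : C ⥤ᵖ D) {p : ℕ} {X Z : C} (x : Path C p X Z) :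
    hat (canonical F p) x = 𝟙 _ :=
  hatAt_canonical _ _ _

theorem hat_naturality {F : C ⥤ᵖ D} {p : ℕ} (φ : Cochain F p) {X Z : C} {x y : Path C p X Z}
    {τ : x.comp ⟶ y.comp} (h : Path.Hom₂ x y τ) :
    hat φ x ≫ F.map₂ τ = F.map₂ τ ≫ hat φ y := by
  obtain ⟨c, t, e⟩ := h.mk_eq
  exact (congrArg (fun o : Σ (s : Str C p X Z) (c : s.Chain), x.comp ⟶ s.comp.obj c =>
    hat φ x ≫ F.map₂ o.2.2 = F.map₂ o.2.2 ≫ hatAt φ o.1 o.2.1) e).mpr (hatAt_naturality φ _ t)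

theorem hat_firstCoface {F : C ⥤ᵖ D} {p : ℕ} (φ : Cochain F p) {X Y Z : C} (x : Path C p X Y)
    (f : Y ⟶ Z) :
    hat (firstCoface φ) (x.cons f) =
      (F.mapComp x.comp f).hom ≫ hat φ x ▷ F.map f ≫ (F.mapComp x.comp f).inv :=
  hatAt_rowFirst φ x.str Z x.chain f

theorem hat_middleCoface {F : C ⥤ᵖ D} {p : ℕ} (i : ℕ) (φ : Cochain F p) {X Z : C}
    (x : Path C (p + 1) X Z) :
    hat φ (x.merge i) ≫ F.map₂ (x.mergeTo i) =
      F.map₂ (x.mergeTo i) ≫ hat (middleCoface i φ) x :=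
  (congrArg (fun o : Σ (s : Str C p X Z) (c : s.Chain), s.comp.obj c ⟶ x.comp =>
    hatAt φ o.1 o.2.1 ≫ F.map₂ o.2.2 = F.map₂ o.2.2 ≫ hat (middleCoface i φ) x)
      (x.mk_merge i)).mpr (hatAt_rowMiddle i φ x.str x.chain)

theorem hat_lastCoface {F : C ⥤ᵖ D} {p : ℕ} (φ : Cochain F p) {W X Z : C}
    (f : W ⟶ X) (x : Path C p X Z) :
    F.map f ◁ hat φ x ≫ (F.mapComp f x.comp).inv ≫ F.map₂ (x.snocTo f) =
      ((F.mapComp f x.comp).inv ≫ F.map₂ (x.snocTo f)) ≫ hat (lastCoface φ) (x.snoc f) :=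
  (congrArg (fun o : Σ (Y : C) (f' : W ⟶ Y) (s : Str C p Y Z) (c : s.Chain),
        f' ≫ s.comp.obj c ⟶ (x.snoc f).comp =>
    F.map o.2.1 ◁ hatAt φ o.2.2.1 o.2.2.2.1 ≫
        (F.mapComp o.2.1 (o.2.2.1.comp.obj o.2.2.2.1)).inv ≫ F.map₂ o.2.2.2.2 =
      ((F.mapComp o.2.1 (o.2.2.1.comp.obj o.2.2.2.1)).inv ≫ F.map₂ o.2.2.2.2) ≫
        hat (lastCoface φ) (x.snoc f))
      (x.mk_snoc f)).mpr (hatAt_rowLast φ (x.snoc f).str (x.snoc f).chain)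

theorem hat_pullback {G : C ⥤ᵖ D} {F : D ⥤ᵖ E} {p : ℕ} (φ : Cochain F p) {X Z : C}
    {x : Path C p X Z} {y : Path D p (G.obj X) (G.obj Z)} {θ : y.comp ⟶ G.map x.comp}
    (h : Path.IsImage G x y θ) :
    hat φ y ≫ F.map₂ θ = F.map₂ θ ≫ hat (pullback G F φ) x :=
  (congrArg (fun o : Σ (s : Str D p (G.obj X) (G.obj Z)) (c : s.Chain),
      s.comp.obj c ⟶ G.map x.comp =>
    hatAt φ o.1 o.2.1 ≫ F.map₂ o.2.2 = F.map₂ o.2.2 ≫ hat (pullback G F φ) x) h.mk_eq).mpr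
    (hatAt_pullback G φ x.str x.chain)

theorem hat_tensorCochain {A : Type u₃} [Bicategory.{w₃, v₃} A] (T : (A × D) ⥤ᵖ E)
    {G : C ⥤ᵖ A} {F : C ⥤ᵖ D} {p : ℕ} (α : Cochain G p) (β : Cochain F p) {X Z : C}
    (x : Path C p X Z) :
    hat (tensorCochain T G F α β) x = T.map₂ (hat α x ×ₘ hat β x) :=
  hatAt_tensorCochain T α β x.str x.chain

end Hats
-- Row cofaces commute with pullback.
section Compatibility

variable {C : Type u} [Bicategory.{w, v} C] {D : Type u₁} [Bicategory.{w₁, v₁} D]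
  {E : Type u₂} [Bicategory.{w₂, v₂} E]

theorem comp_whiskerRight_mapComp_inv (G : C ⥤ᵖ D) {X Y Z : C} {l l' : X ⟶ Y} (g : Y ⟶ Z)
    {k k' n : G.obj X ⟶ G.obj Y} (m : n ⟶ k) (θ : k ⟶ G.map l) (τ : n ⟶ k') (θ' : k' ⟶ G.map l')
    (t : l' ⟶ l) (h : m ≫ θ = τ ≫ θ' ≫ G.map₂ t) :
    m ▷ G.map g ≫ θ ▷ G.map g ≫ (G.mapComp l g).inv =
      (τ ▷ G.map g ≫ k' ◁ 𝟙 (G.map g)) ≫ (θ' ▷ G.map g ≫ (G.mapComp l' g).inv) ≫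
        G.map₂ (t ▷ g) := by
  rw [← comp_whiskerRight_assoc, h]
  simp

namespace Path

/-- `IsImage` grows at the end of a path, whereas the last coface acts at its start; an induction
along the path is needed to see how the canonical 2-morphism changes there. -/
theorem IsImage.snoc {G : C ⥤ᵖ D} {p : ℕ} {W X Z : C} (f : W ⟶ X) {x : Path C p X Z}
    {y : Path D p (G.obj X) (G.obj Z)} {θ : y.comp ⟶ G.map x.comp} (h : IsImage G x y θ) :
    ∃ θ' : (y.snoc (G.map f)).comp ⟶ G.map (x.snoc f).comp,
      IsImage G (x.snoc f) (y.snoc (G.map f)) θ' ∧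
      y.snocTo (G.map f) ≫ θ' =
        G.map f ◁ θ ≫ (G.mapComp f x.comp).inv ≫ G.map₂ (x.snocTo f) := by
  induction h with
  | single g =>
    refine ⟨_, .cons (.single f) g, ?_⟩
    change 𝟙 _ ≫ 𝟙 (G.map f) ▷ G.map g ≫ (G.mapComp f g).inv =
      G.map f ◁ 𝟙 (G.map g) ≫ (G.mapComp f g).inv ≫ G.map₂ (𝟙 (f ≫ g))
    simp
  | @cons p X Y Z x y θ h g ih =>
    obtain ⟨θ', h', e⟩ := ih f
    refine ⟨_, h'.cons g, ?_⟩
    change ((α_ (G.map f) y.comp (G.map g)).inv ≫ y.snocTo (G.map f) ▷ G.map g) ≫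
        θ' ▷ G.map g ≫ (G.mapComp (x.snoc f).comp g).inv =
      G.map f ◁ (θ ▷ G.map g ≫ (G.mapComp x.comp g).inv) ≫ (G.mapComp f (x.comp ≫ g)).inv ≫
        G.map₂ ((α_ f x.comp g).inv ≫ x.snocTo f ▷ g)
    rw [Category.assoc, ← comp_whiskerRight_assoc, e]
    simp [map₂_associator_inv_eq]

/-- Merging the image path yields an entry G(f) ≫ G(g) where the image of the merged path has G(f ≫
g). The 2-morphism `τ` is the composition constraint in that entry and the identity in all others;
naturality of cochains will be applied to it. -/
theorem exists_isImage_merge (G : C ⥤ᵖ D) : ∀ {p : ℕ} {X Z : C} (x : Path C (p + 1) X Z) (i : ℕ),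
    ∃ (y : Path D (p + 1) (G.obj X) (G.obj Z)) (θ : y.comp ⟶ G.map x.comp)
      (y' : Path D p (G.obj X) (G.obj Z)) (θ' : y'.comp ⟶ G.map (x.merge i).comp)
      (τ : (y.merge i).comp ⟶ y'.comp),
      IsImage G x y θ ∧ IsImage G (x.merge i) y' θ' ∧ Hom₂ (y.merge i) y' τ ∧
        y.mergeTo i ≫ θ = τ ≫ θ' ≫ G.map₂ (x.mergeTo i)
  | _, _, _, .cons (.single f) g, _ => by
    refine ⟨.cons (.single (G.map f)) (G.map g), _, .single (G.map (f ≫ g)), _, _,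
      (IsImage.single f).cons g, .single (f ≫ g),
      Hom₂.single (G.mapComp f g).inv, ?_⟩
    change 𝟙 _ ≫ 𝟙 (G.map f) ▷ G.map g ≫ (G.mapComp f g).inv =
      (G.mapComp f g).inv ≫ 𝟙 (G.map (f ≫ g)) ≫ G.map₂ (𝟙 (f ≫ g))
    simp
  | _, _, _, .cons (.cons x f) g, 0 => by
    obtain ⟨y, θ, h⟩ := exists_isImage G x
    refine ⟨_, _, _, _, _, (h.cons f).cons g, h.cons (f ≫ g),
      (Hom₂.refl y).cons (G.mapComp f g).inv, ?_⟩
    change (α_ y.comp (G.map f) (G.map g)).inv ≫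
        (θ ▷ G.map f ≫ (G.mapComp x.comp f).inv) ▷ G.map g ≫ (G.mapComp (x.comp ≫ f) g).inv =
      (𝟙 y.comp ▷ (G.map f ≫ G.map g) ≫ y.comp ◁ (G.mapComp f g).inv) ≫
        (θ ▷ G.map (f ≫ g) ≫ (G.mapComp x.comp (f ≫ g)).inv) ≫ G.map₂ (α_ x.comp f g).inv
    rw [← mapComp_inv_associator_inv]
    simp
  | _, _, _, .cons (.cons x f) g, i + 1 => by
    obtain ⟨y, θ, y', θ', τ, h, h', k, e⟩ := exists_isImage_merge G (.cons x f) i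
    -- This exposes the last entry of `y`, so that merging at index `i + 1` reduces.
    cases h with
    | @cons _ _ _ _ _ y θ h f =>
    refine ⟨_, _, _, _, _, (h.cons f).cons g, h'.cons g, k.cons (𝟙 (G.map g)), ?_⟩
    exact comp_whiskerRight_mapComp_inv G g _ _ _ _ _ e

end Path

theorem conj_whiskerRight_comp (G : C ⥤ᵖ D) (F : D ⥤ᵖ E) {X Y Z : C} (l : X ⟶ Y) (f : Y ⟶ Z)
    {k : G.obj X ⟶ G.obj Y} (θ : k ⟶ G.map l) (a : F.map k ⟶ F.map k)
    (b : F.map (G.map l) ⟶ F.map (G.map l)) (h : a ≫ F.map₂ θ = F.map₂ θ ≫ b) :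
    F.map₂ (θ ▷ G.map f ≫ (G.mapComp l f).inv) ≫
        (F.map₂ (G.mapComp l f).hom ≫ (F.mapComp (G.map l) (G.map f)).hom) ≫
          b ▷ F.map (G.map f) ≫
            (F.mapComp (G.map l) (G.map f)).inv ≫ F.map₂ (G.mapComp l f).inv =
      ((F.mapComp k (G.map f)).hom ≫ a ▷ F.map (G.map f) ≫ (F.mapComp k (G.map f)).inv) ≫
        F.map₂ (θ ▷ G.map f ≫ (G.mapComp l f).inv) := by
  have h' := congrArg (fun t => t ▷ F.map (G.map f)) h
  simp only [comp_whiskerRight] at h'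
  rw [F.map₂_comp, F.map₂_whisker_right]
  simp only [Category.assoc, Iso.inv_hom_id_assoc]
  rw [← F.map₂_comp_assoc, Iso.inv_hom_id, F.map₂_id, Category.id_comp,
    Iso.inv_hom_id_assoc, reassoc_of% h']

/-- Both `d` and `d'` are the conjugate of `a` along the isomorphism `m' ≫ θ`, computed along the
two sides of `e`. In the application `a` is the hat of φ at the merged image path, and the two
routes are pulling back before merging and merging before pulling back. -/
theorem eq_of_comp_eq_comp {A : Type*} [Category A] {P Q R S N : A} {a : P ⟶ P} {a' : Q ⟶ Q}
    {b : R ⟶ R} {c : N ⟶ N} {d d' : S ⟶ S} {τ : P ⟶ Q} {θ' : Q ⟶ R} {m : R ⟶ S} {m' : P ⟶ N}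
    {θ : N ⟶ S} (_ : IsIso m') (_ : IsIso θ) (h₁ : a ≫ τ = τ ≫ a') (h₂ : a' ≫ θ' = θ' ≫ b)
    (h₃ : b ≫ m = m ≫ d) (h₄ : a ≫ m' = m' ≫ c) (h₅ : c ≫ θ = θ ≫ d')
    (e : m' ≫ θ = τ ≫ θ' ≫ m) : d = d' := by
  rw [← cancel_epi (m' ≫ θ), Category.assoc m' θ d', ← h₅, ← reassoc_of% h₄, e, Category.assoc,
    Category.assoc, ← h₃, ← reassoc_of% h₂, ← reassoc_of% h₁]

theorem eq_of_whiskerLeft_comp_eq {X Y Z : D} {f : X ⟶ Y} {k l : Y ⟶ Z} {m n : X ⟶ Z}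
    {a : k ⟶ k} {b : l ⟶ l} {c : m ⟶ m} {d d' : n ⟶ n} {t : k ⟶ l} {r : f ≫ k ⟶ m}
    {s : f ≫ l ⟶ n} {u : m ⟶ n} (_ : IsIso r) (_ : IsIso u) (h₁ : a ≫ t = t ≫ b)
    (h₂ : c ≫ u = u ≫ d') (h₃ : f ◁ a ≫ r = r ≫ c) (h₄ : f ◁ b ≫ s = s ≫ d)
    (e : r ≫ u = f ◁ t ≫ s) : d = d' := by
  rw [← cancel_epi (r ≫ u), Category.assoc r u d', ← h₂, ← reassoc_of% h₃, e, Category.assoc,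
    ← h₄, ← whiskerLeft_comp_assoc, ← whiskerLeft_comp_assoc, h₁]

theorem mapComp_inv_comp_map₂ (G : C ⥤ᵖ D) (F : D ⥤ᵖ E) {W X Z : C} (f : W ⟶ X) (l : X ⟶ Z)
    {m : W ⟶ Z} {k : G.obj X ⟶ G.obj Z} {n : G.obj W ⟶ G.obj Z} (s : G.map f ≫ k ⟶ n)
    (t : f ≫ l ⟶ m) (θ : k ⟶ G.map l) (θ' : n ⟶ G.map m)
    (e : s ≫ θ' = G.map f ◁ θ ≫ (G.mapComp f l).inv ≫ G.map₂ t) :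
    ((F.mapComp (G.map f) k).inv ≫ F.map₂ s) ≫ F.map₂ θ' =
      F.map (G.map f) ◁ F.map₂ θ ≫
        ((F.mapComp (G.map f) (G.map l)).inv ≫ F.map₂ (G.mapComp f l).inv) ≫
          F.map₂ (G.map₂ t) := by
  rw [Category.assoc, ← F.map₂_comp, e]
  simp

theorem firstCoface_pullback (G : C ⥤ᵖ D) {F : D ⥤ᵖ E} {p : ℕ} (φ : Cochain F p) :
    firstCoface (pullback G F φ) = pullback G F (firstCoface φ) := by
  refine hat_ext fun {X Z} x => ?_
  cases x with
  | @cons _ _ Y _ x f =>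
    obtain ⟨y, θ, h⟩ := x.exists_isImage G
    have h₁ := hat_pullback φ h
    have h₂ := hat_pullback (firstCoface φ) (h.cons f)
    have : IsIso (θ ▷ G.map f ≫ (G.mapComp x.comp f).inv) := (h.cons f).isIso
    rw [hat_firstCoface] at h₂ ⊢
    exact (cancel_epi (F.map₂ (θ ▷ G.map f ≫ (G.mapComp x.comp f).inv))).1
      ((conj_whiskerRight_comp G F x.comp f θ _ _ h₁).trans h₂)

theorem middleCoface_pullback (G : C ⥤ᵖ D) {F : D ⥤ᵖ E} {p : ℕ} (i : ℕ) (φ : Cochain F p) :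
    middleCoface i (pullback G F φ) = pullback G F (middleCoface i φ) := by
  refine hat_ext fun {X Z} x => ?_
  obtain ⟨y, θ, y', θ', τ, h, h', k, e⟩ := x.exists_isImage_merge G i
  have := h.isIso
  have e' := congrArg (fun t => F.map₂ t) e
  simp only [F.map₂_comp] at e'
  exact eq_of_comp_eq_comp (inferInstanceAs (IsIso (F.map₂ (y.mergeTo i))))
    (inferInstanceAs (IsIso (F.map₂ θ))) (hat_naturality φ k) (hat_pullback φ h')
    (hat_middleCoface i (pullback G F φ) x) (hat_middleCoface i φ y)
    (hat_pullback (middleCoface i φ) h) e'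

theorem lastCoface_pullback (G : C ⥤ᵖ D) {F : D ⥤ᵖ E} {p : ℕ} (φ : Cochain F p) :
    lastCoface (pullback G F φ) = pullback G F (lastCoface φ) := by
  refine hat_ext fun {X Z} x => ?_
  obtain ⟨Y, f, x, rfl⟩ := x.exists_eq_snoc
  obtain ⟨y, θ, h⟩ := x.exists_isImage G
  obtain ⟨θ', h', e⟩ := h.snoc f
  have := h'.isIso
  exact eq_of_whiskerLeft_comp_eq
    (inferInstanceAs (IsIso ((F.mapComp (G.map f) y.comp).inv ≫ F.map₂ (y.snocTo (G.map f)))))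
    (inferInstanceAs (IsIso (F.map₂ θ'))) (hat_pullback φ h) (hat_pullback (lastCoface φ) h')
    (hat_lastCoface φ (G.map f) y) (hat_lastCoface (pullback G F φ) f x)
    (mapComp_inv_comp_map₂ G F f x.comp _ _ θ θ' e)

end Compatibility
-- Row cofaces of canonical, tensored and transported cochains.
section Compatibility

variable {C : Type u} [Bicategory.{w, v} C] {D : Type u₁} [Bicategory.{w₁, v₁} D]
  {E : Type u₂} [Bicategory.{w₂, v₂} E] {A : Type u₃} [Bicategory.{w₃, v₃} A]

theorem firstCoface_canonical (F : C ⥤ᵖ D) (p : ℕ) :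
    firstCoface (canonical F p) = canonical F (p + 1) := by
  refine hat_ext fun {X Z} x => ?_
  cases x with
  | cons x f =>
    rw [hat_firstCoface, hat_canonical, hat_canonical, id_whiskerRight, Category.id_comp,
      Iso.hom_inv_id]
    rfl

theorem middleCoface_canonical (F : C ⥤ᵖ D) (p i : ℕ) :
    middleCoface i (canonical F p) = canonical F (p + 1) := by
  refine hat_ext fun {X Z} x => ?_
  have h := hat_middleCoface i (canonical F p) x
  rw [hat_canonical, Category.id_comp] at h
  rw [hat_canonical, ← cancel_epi (F.map₂ (x.mergeTo i)), ← h, Category.comp_id]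

theorem lastCoface_canonical (F : C ⥤ᵖ D) (p : ℕ) :
    lastCoface (canonical F p) = canonical F (p + 1) := by
  refine hat_ext fun {X Z} x => ?_
  obtain ⟨Y, f, x, rfl⟩ := x.exists_eq_snoc
  have h := hat_lastCoface (canonical F p) f x
  rw [hat_canonical, whiskerLeft_id, Category.id_comp] at h
  rw [hat_canonical, ← cancel_epi ((F.mapComp f x.comp).inv ≫ F.map₂ (x.snocTo f)), ← h,
    Category.comp_id]

/-- The composition constraint of a composite pseudofunctor is the F-image of that of G followed by
that of F. It is applied with a pairing as G and the tensor product as F. -/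
theorem map₂_conj_whiskerRight (G : C ⥤ᵖ D) (F : D ⥤ᵖ E) {X Y Z : C} (l : X ⟶ Y) (f : Y ⟶ Z)
    (a : G.map l ⟶ G.map l) :
    (F.map₂ (G.mapComp l f).hom ≫ (F.mapComp (G.map l) (G.map f)).hom) ≫
      F.map₂ a ▷ F.map (G.map f) ≫
        (F.mapComp (G.map l) (G.map f)).inv ≫ F.map₂ (G.mapComp l f).inv =
    F.map₂ ((G.mapComp l f).hom ≫ a ▷ G.map f ≫ (G.mapComp l f).inv) := by
  simp

theorem map₂_whiskerLeft_comp (G : C ⥤ᵖ D) (F : D ⥤ᵖ E) {X Y Z : C} (f : X ⟶ Y) (l : Y ⟶ Z)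
    {m : X ⟶ Z} (t : f ≫ l ⟶ m) (a : G.map l ⟶ G.map l) (b : G.map m ⟶ G.map m)
    (h : G.map f ◁ a ≫ (G.mapComp f l).inv ≫ G.map₂ t =
      ((G.mapComp f l).inv ≫ G.map₂ t) ≫ b) :
    F.map (G.map f) ◁ F.map₂ a ≫
        ((F.mapComp (G.map f) (G.map l)).inv ≫ F.map₂ (G.mapComp f l).inv) ≫ F.map₂ (G.map₂ t) =
      (((F.mapComp (G.map f) (G.map l)).inv ≫ F.map₂ (G.mapComp f l).inv) ≫
        F.map₂ (G.map₂ t)) ≫ F.map₂ b := by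
  have h' := congrArg (fun t => (F.mapComp (G.map f) (G.map l)).inv ≫ F.map₂ t) h
  simpa using h'

/-- The hat of a tensor product is `T.map₂` of the pair of hats, and a product bicategory is
componentwise. So the coface formulas of the two factors form one formula for the pair, to which T
is applied; the same holds for the other cofaces. -/
theorem firstCoface_tensorCochain (T : (A × D) ⥤ᵖ E) (G : C ⥤ᵖ A) (F : C ⥤ᵖ D) {p : ℕ}
    (α : Cochain G p) (β : Cochain F p) :
    firstCoface (tensorCochain T G F α β) =
      tensorCochain T G F (firstCoface α) (firstCoface β) := by
  refine hat_ext fun {X Z} x => ?_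
  cases x with
  | cons x f =>
    rw [hat_firstCoface, hat_tensorCochain, hat_tensorCochain, hat_firstCoface, hat_firstCoface]
    exact map₂_conj_whiskerRight (pair G F) T x.comp f (hat α x ×ₘ hat β x)

theorem middleCoface_tensorCochain (T : (A × D) ⥤ᵖ E) (G : C ⥤ᵖ A) (F : C ⥤ᵖ D) {p : ℕ} (i : ℕ)
    (α : Cochain G p) (β : Cochain F p) :
    middleCoface i (tensorCochain T G F α β) =
      tensorCochain T G F (middleCoface i α) (middleCoface i β) := by
  refine hat_ext fun {X Z} x => ?_
  have h := hat_middleCoface i (tensorCochain T G F α β) x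
  rw [hat_tensorCochain] at h
  refine (cancel_epi (((pair G F).comp T).map₂ (x.mergeTo i))).1 (h.symm.trans ?_)
  refine Eq.trans ?_ (congrArg (_ ≫ ·) (hat_tensorCochain T _ _ x).symm)
  refine (T.map₂_comp _ _).symm.trans (Eq.trans ?_ (T.map₂_comp _ _))
  exact congrArg (fun t => T.map₂ t)
    (Prod.ext (hat_middleCoface i α x) (hat_middleCoface i β x))

theorem lastCoface_tensorCochain (T : (A × D) ⥤ᵖ E) (G : C ⥤ᵖ A) (F : C ⥤ᵖ D) {p : ℕ}
    (α : Cochain G p) (β : Cochain F p) :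
    lastCoface (tensorCochain T G F α β) =
      tensorCochain T G F (lastCoface α) (lastCoface β) := by
  refine hat_ext fun {X Z} x => ?_
  obtain ⟨Y, f, x, rfl⟩ := x.exists_eq_snoc
  have h := hat_lastCoface (tensorCochain T G F α β) f x
  rw [hat_tensorCochain] at h
  refine (cancel_epi ((((pair G F).comp T).mapComp f x.comp).inv ≫
    ((pair G F).comp T).map₂ (x.snocTo f))).1 (h.symm.trans ?_)
  refine Eq.trans ?_ (congrArg (_ ≫ ·) (hat_tensorCochain T _ _ (x.snoc f)).symm)
  exact map₂_whiskerLeft_comp (pair G F) T f x.comp (x.snocTo f) (hat α x ×ₘ hat β x)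
    (hat (lastCoface α) (x.snoc f) ×ₘ hat (lastCoface β) (x.snoc f))
    (Prod.ext (hat_lastCoface α f x) (hat_lastCoface β f x))

theorem firstCoface_transport {F G : C ⥤ᵖ D} (h : F = G) {p : ℕ} (φ : Cochain F p) :
    firstCoface (transport h φ) = transport h (firstCoface φ) := by
  subst h
  rfl

theorem middleCoface_transport {F G : C ⥤ᵖ D} (h : F = G) {p : ℕ} (i : ℕ) (φ : Cochain F p) :
    middleCoface i (transport h φ) = transport h (middleCoface i φ) := by
  subst h
  rfl

theorem lastCoface_transport {F G : C ⥤ᵖ D} (h : F = G) {p : ℕ} (φ : Cochain F p) :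
    lastCoface (transport h φ) = transport h (lastCoface φ) := by
  subst h
  rfl

end Compatibility

/-! ### Cochains bundled with their pseudofunctor. -/

section TotalCochains

variable {C : Type u} [Bicategory.{w, v} C] {D : Type u₁} [Bicategory.{w₁, v₁} D]
  {E : Type u₂} [Bicategory.{w₂, v₂} E] {A : Type u₃} [Bicategory.{w₃, v₃} A]

theorem Path.IsImage.trans {G : C ⥤ᵖ D} {H : D ⥤ᵖ E} {p : ℕ} {X Z : C} {x : Path C p X Z}
    {y : Path D p (G.obj X) (G.obj Z)} {θ : y.comp ⟶ G.map x.comp} (h : IsImage G x y θ) :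
    ∀ {z : Path E p (H.obj (G.obj X)) (H.obj (G.obj Z))} {θ' : z.comp ⟶ H.map y.comp}
      (_ : IsImage H y z θ'), IsImage (G.comp H) x z (θ' ≫ H.map₂ θ) := by
  induction h with
  | single f =>
    intro z θ' h'
    cases h'
    have e : 𝟙 (H.map (G.map f)) ≫ H.map₂ (𝟙 (G.map f)) = 𝟙 (H.map (G.map f)) := by simp
    exact e.symm ▸ IsImage.single (G := G.comp H) f
  | @cons p X Y Z x y θ h f ih =>
    intro z θ' h'
    cases h' with
    | @cons _ _ _ _ _ z θ' h' _ =>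
    have e : (θ' ▷ H.map (G.map f) ≫ (H.mapComp y.comp (G.map f)).inv) ≫
        H.map₂ (θ ▷ G.map f ≫ (G.mapComp x.comp f).inv) =
      (θ' ≫ H.map₂ θ) ▷ H.map (G.map f) ≫ (H.mapComp (G.map x.comp) (G.map f)).inv ≫
        H.map₂ (G.mapComp x.comp f).inv := by simp
    exact e.symm ▸ (ih h').cons f

theorem eq_of_comp_eq_comp₂ {A : Type*} [Category A] {P Q R : A} {a : P ⟶ P} {b : Q ⟶ Q}
    {d d' : R ⟶ R} {s : P ⟶ Q} {t : Q ⟶ R} {r : P ⟶ R} (_ : IsIso s) (_ : IsIso t)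
    (h₁ : a ≫ s = s ≫ b) (h₂ : b ≫ t = t ≫ d) (h₃ : a ≫ r = r ≫ d') (e : r = s ≫ t) : d = d' := by
  subst e
  rw [← cancel_epi (s ≫ t), ← h₃, reassoc_of% h₁, h₂, Category.assoc]

variable (C D) in
/-- Pairs of a pseudofunctor and a cochain of it. -/
abbrev TotalCochain (p : ℕ) : Type _ := Σ F : C ⥤ᵖ D, Cochain F p

namespace TotalCochain

/-- The vertical identities compare cochains of pseudofunctors that are only propositionally equal.
In the bundled type transports disappear (`mk_transport`), and the comparison is made on hats. -/
theorem ext_hat {p : ℕ} {F F' : C ⥤ᵖ D} {φ : Cochain F p} {φ' : Cochain F' p} (e : F = F')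
    (h : ∀ {X Z : C} (x : Path C p X Z), HEq (hat φ x) (hat φ' x)) :
    (⟨F, φ⟩ : TotalCochain C D p) = ⟨F', φ'⟩ := by
  subst e
  exact congrArg (Sigma.mk F) (hat_ext fun x => eq_of_heq (h x))

theorem mk_transport {F F' : C ⥤ᵖ D} (h : F = F') {p : ℕ} (φ : Cochain F p) :
    (⟨F', transport h φ⟩ : TotalCochain C D p) = ⟨F, φ⟩ := by
  subst h
  rfl

/-- The canonical cochain. -/
def can (F : C ⥤ᵖ D) (p : ℕ) : TotalCochain C D p := ⟨F, canonical F p⟩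

/-- The pullback of cochains. -/
def pb (G : C ⥤ᵖ D) {p : ℕ} (Φ : TotalCochain D E p) : TotalCochain C E p :=
  ⟨G.comp Φ.1, pullback G Φ.1 Φ.2⟩

/-- The tensor product of cochains. -/
def tensor (T : (A × D) ⥤ᵖ E) {p : ℕ} (Φ : TotalCochain C A p) (Ψ : TotalCochain C D p) :
    TotalCochain C E p :=
  ⟨(pair Φ.1 Ψ.1).comp T, tensorCochain T Φ.1 Ψ.1 Φ.2 Ψ.2⟩

/-- The two bracketings of the composite agree definitionally on 1-morphisms, so the hats have the
same type; they are equal because an image of an image is an image under the composite. -/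
theorem pb_pb (G : C ⥤ᵖ D) (H : D ⥤ᵖ E) {p : ℕ} (Φ : TotalCochain E A p) :
    pb G (pb H Φ) = pb (G.comp H) Φ := by
  obtain ⟨F, φ⟩ := Φ
  refine ext_hat (comp_assoc G H F).symm fun {X Z} x => heq_of_eq ?_
  obtain ⟨y, θ, h⟩ := x.exists_isImage G
  obtain ⟨z, θ', h'⟩ := y.exists_isImage H
  have := h.isIso
  have := h'.isIso
  exact eq_of_comp_eq_comp₂ (inferInstanceAs (IsIso (F.map₂ θ')))
    (inferInstanceAs (IsIso (F.map₂ (H.map₂ θ)))) (hat_pullback φ h')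
    (hat_pullback (pullback H F φ) h) (hat_pullback φ (h.trans h')) (F.map₂_comp θ' (H.map₂ θ))

theorem pb_can (G : C ⥤ᵖ D) (F : D ⥤ᵖ E) (p : ℕ) : pb G (can F p) = can (G.comp F) p := by
  refine ext_hat rfl fun {X Z} x => heq_of_eq ?_
  obtain ⟨y, θ, h⟩ := x.exists_isImage G
  have h₁ := hat_pullback (canonical F p) h
  have := h.isIso
  rw [hat_canonical, Category.id_comp] at h₁
  exact ((cancel_epi (F.map₂ θ)).1 (h₁.symm.trans (Category.comp_id _).symm)).trans
    (hat_canonical (G.comp F) x).symm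

theorem pb_tensor {B : Type*} [Bicategory B] (H : C ⥤ᵖ B) {p : ℕ} (T : (A × D) ⥤ᵖ E)
    (Φ : TotalCochain B A p)
    (Ψ : TotalCochain B D p) : pb H (tensor T Φ Ψ) = tensor T (pb H Φ) (pb H Ψ) := by
  obtain ⟨G, α⟩ := Φ
  obtain ⟨F, β⟩ := Ψ
  have e : H.comp ((pair G F).comp T) = (pair (H.comp G) (H.comp F)).comp T := by
    rw [← comp_pair, comp_assoc]
  refine ext_hat e fun {X Z} x => heq_of_eq ?_
  obtain ⟨y, θ, h⟩ := x.exists_isImage H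
  have h₁ := hat_pullback (tensorCochain T G F α β) h
  have := h.isIso
  rw [hat_tensorCochain] at h₁
  refine (cancel_epi (((pair G F).comp T).map₂ θ)).1 (h₁.symm.trans ?_)
  refine Eq.trans ?_ (congrArg (_ ≫ ·)
    (hat_tensorCochain T (pullback H G α) (pullback H F β) x).symm)
  refine (T.map₂_comp _ _).symm.trans (Eq.trans ?_ (T.map₂_comp _ _))
  exact congrArg (fun t => T.map₂ t) (Prod.ext (hat_pullback α h) (hat_pullback β h))

theorem tensor_can (T : (A × D) ⥤ᵖ E) (G : C ⥤ᵖ A) (F : C ⥤ᵖ D) (p : ℕ) :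
    tensor T (can G p) (can F p) = can ((pair G F).comp T) p := by
  refine ext_hat rfl fun {X Z} x => heq_of_eq ?_
  refine (hat_tensorCochain T _ _ x).trans (Eq.trans ?_ (hat_canonical _ x).symm)
  refine Eq.trans ?_ (T.map₂_id _)
  exact congrArg (fun t => T.map₂ t) (Prod.ext (hat_canonical G x) (hat_canonical F x))

/-- The two hats are the values of (X ⊗ Y) ⊗ Z and X ⊗ (Y ⊗ Z) on the same triple of hats, and these
pseudofunctors are equal. The equality is heterogeneous because the values on 1-morphisms agree only
propositionally. -/
theorem tensor_assoc {K : Type*} [CommRing K] {B : Type u₁} [Bicategory.{w₁, v₁} B]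
    [∀ X Y : B, Preadditive (X ⟶ Y)] [∀ X Y : B, Linear K (X ⟶ Y)] (G : GraySemigroup K B) {p : ℕ}
    (Φ Ψ Ω : TotalCochain C B p) :
    tensor G.tensor (tensor G.tensor Φ Ψ) Ω = tensor G.tensor Φ (tensor G.tensor Ψ Ω) := by
  refine ext_hat (G.assoc_comp _ _ _) fun {X Z} x => ?_
  let m : (pair Φ.1 (pair Ψ.1 Ω.1)).map x.comp ⟶ (pair Φ.1 (pair Ψ.1 Ω.1)).map x.comp :=
    (hat Φ.2 x, (hat Ψ.2 x, hat Ω.2 x))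
  have h : HEq ((tensorLeft G.tensor).map₂ m) ((tensorRight G.tensor).map₂ m) := by
    rw [G.assoc]
  have h₁ := hat_tensorCochain G.tensor (tensorCochain G.tensor Φ.1 Ψ.1 Φ.2 Ψ.2) Ω.2 x
  have h₂ := hat_tensorCochain G.tensor Φ.2 (tensorCochain G.tensor Ψ.1 Ω.1 Ψ.2 Ω.2) x
  rw [hat_tensorCochain G.tensor Φ.2 Ψ.2 x] at h₁
  rw [hat_tensorCochain G.tensor Ψ.2 Ω.2 x] at h₂
  exact (heq_of_eq h₁).trans (h.trans (heq_of_eq h₂.symm))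

end TotalCochain
end TotalCochains
end GrayComplex

namespace GrayComplex
namespace GraySemigroup

/-! ### Pseudofunctors into powers of `B`, by components. -/

section Powers

variable {B : Type u} [Bicategory.{w, v} B] {P : Type u₁} [Bicategory.{w₁, v₁} P]

/-- The pseudofunctor into a power of `B` with first component `x` and other components `y`. -/
def consPower {q : ℕ} (x : P ⥤ᵖ B) (y : P ⥤ᵖ Power B q) : P ⥤ᵖ Power B (q + 1) := pair x y

/-- Allows arguments with generalised elements: identities between pseudofunctors on a power of B
are checked after composing with an arbitrary F, split into its components, and then read off at the
identity. -/
theorem exists_eq_consPower {q : ℕ} (F : P ⥤ᵖ Power B (q + 1)) :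
    ∃ (x : P ⥤ᵖ B) (y : P ⥤ᵖ Power B q), F = consPower x y := by
  refine ⟨F.comp (proj₁ B (Power B q)), F.comp (proj₂ B (Power B q)), ?_⟩
  exact (comp_id F).symm.trans ((congrArg F.comp pair_proj.symm).trans (comp_pair _ _ _))

theorem comp_proj₂_comp {D : Type u₂} [Bicategory.{w₂, v₂} D] {q : ℕ} (x : P ⥤ᵖ B)
    (y : P ⥤ᵖ Power B q) (H : Power B q ⥤ᵖ D) :
    (pair x y).comp ((proj₂ B (Power B q)).comp H) = y.comp H := by
  rw [← comp_assoc, pair_proj₂]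

theorem consPower_front_succ {q : ℕ} (x : P ⥤ᵖ B) (y : P ⥤ᵖ Power B (q + 1)) :
    (consPower x y).comp (front B (q + 1)) = consPower x (y.comp (front B q)) :=
  (comp_pair (pair x y) _ _).trans
    (congrArg₂ pair (pair_proj₁ x y) (comp_proj₂_comp x y (front B q)))

theorem consPower_last_succ {q : ℕ} (x : P ⥤ᵖ B) (y : P ⥤ᵖ Power B (q + 1)) :
    (consPower x y).comp (last B (q + 1)) = y.comp (last B q) :=
  comp_proj₂_comp x y (last B q)

theorem consPower_front_zero (x : P ⥤ᵖ B) (y : P ⥤ᵖ Power B 0) :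
    (consPower x y).comp (front B 0) = x := pair_proj₁ x y

theorem consPower_last_zero (x : P ⥤ᵖ B) (y : P ⥤ᵖ Power B 0) :
    (consPower x y).comp (last B 0) = y := pair_proj₂ x y

variable (B) in
/-- The projection of a power of `B` to the first component. -/
def headPower (q : ℕ) : Power B (q + 1) ⥤ᵖ B := proj₁ B (Power B q)

variable (B) in
/-- The projection of a power of `B` to the components other than the first. -/
def tailPower (q : ℕ) : Power B (q + 1) ⥤ᵖ Power B q := proj₂ B (Power B q)

end Powers

variable {K : Type*} [CommRing K] {B : Type u} [Bicategory.{w, v} B]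
  [∀ X Y : B, Preadditive (X ⟶ Y)] [∀ X Y : B, Linear K (X ⟶ Y)] (G : GraySemigroup K B)

/-! ### Identities between the face, front and last pseudofunctors. -/

section Faces

variable {P : Type u₁} [Bicategory.{w₁, v₁} P]

theorem consPower_face_succ {q : ℕ} (i : ℕ) (x : P ⥤ᵖ B) (y : P ⥤ᵖ Power B (q + 1)) :
    (consPower x y).comp (G.face (q + 1) (i + 1)) = consPower x (y.comp (G.face q i)) :=
  (comp_pair (pair x y) _ _).trans
    (congrArg₂ pair (pair_proj₁ x y) (comp_proj₂_comp x y (G.face q i)))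

theorem consPower_face_zero {q : ℕ} (x y : P ⥤ᵖ B) (z : P ⥤ᵖ Power B q) :
    (consPower x (consPower y z)).comp (G.face (q + 1) 0) =
      consPower ((pair x y).comp G.tensor) z := by
  refine (comp_pair (pair x (pair y z)) _ _).trans (congrArg₂ pair ?_ ?_)
  · rw [← comp_assoc, comp_pair, pair_proj₁]
    exact congrArg (fun F => (pair x F).comp G.tensor)
      ((comp_proj₂_comp x (consPower y z) (proj₁ B (Power B q))).trans (pair_proj₁ y z))
  · exact (comp_proj₂_comp x (consPower y z) (proj₂ B (Power B q))).trans (pair_proj₂ y z)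

/-- Common leading components are stripped until `a = 0`. If then also `c = 0`, the two tensorings
overlap in a variable and associativity of ⊗ is needed; otherwise they are disjoint and commute on
components. -/
theorem comp_face_comp_face : ∀ {q a c : ℕ} (_ : a ≤ c) (_ : c ≤ q) (F : P ⥤ᵖ Power B (q + 2)),
    (F.comp (G.face (q + 1) (c + 1))).comp (G.face q a) =
      (F.comp (G.face (q + 1) a)).comp (G.face q c)
  | 0, 0, 0, _, _, F => by
    obtain ⟨x, F, rfl⟩ := exists_eq_consPower F
    obtain ⟨y, z, rfl⟩ := exists_eq_consPower F
    rw [consPower_face_succ, consPower_face_zero]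
    exact (G.assoc_comp x y z).symm
  | 0, _, c + 1, _, h, _ => absurd h (Nat.not_succ_le_zero c)
  | _, a + 1, 0, h, _, _ => absurd h (Nat.not_succ_le_zero a)
  | q + 1, 0, 0, _, _, F => by
    obtain ⟨x, F, rfl⟩ := exists_eq_consPower F
    obtain ⟨y, F, rfl⟩ := exists_eq_consPower F
    obtain ⟨z, F, rfl⟩ := exists_eq_consPower F
    rw [consPower_face_succ, consPower_face_zero, consPower_face_zero, consPower_face_zero,
      consPower_face_zero, assoc_comp]
  | q + 1, 0, c + 1, _, _, F => by
    obtain ⟨x, F, rfl⟩ := exists_eq_consPower F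
    obtain ⟨y, F, rfl⟩ := exists_eq_consPower F
    rw [consPower_face_succ, consPower_face_succ, consPower_face_zero, consPower_face_zero,
      consPower_face_succ]
  | q + 1, a + 1, c + 1, h, h', F => by
    obtain ⟨x, F, rfl⟩ := exists_eq_consPower F
    rw [consPower_face_succ, consPower_face_succ, consPower_face_succ, consPower_face_succ,
      comp_face_comp_face (Nat.le_of_succ_le_succ h) (Nat.le_of_succ_le_succ h') F]

theorem comp_front_comp_face : ∀ {q a : ℕ} (_ : a ≤ q) (F : P ⥤ᵖ Power B (q + 2)),
    (F.comp (front B (q + 1))).comp (G.face q a) = (F.comp (G.face (q + 1) a)).comp (front B q)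
  | 0, 0, _, F => by
    obtain ⟨x, F, rfl⟩ := exists_eq_consPower F
    obtain ⟨y, z, rfl⟩ := exists_eq_consPower F
    rw [consPower_front_succ, consPower_face_zero, consPower_front_zero, consPower_front_zero]
    rfl
  | q + 1, 0, _, F => by
    obtain ⟨x, F, rfl⟩ := exists_eq_consPower F
    obtain ⟨y, F, rfl⟩ := exists_eq_consPower F
    rw [consPower_front_succ, consPower_front_succ, consPower_face_zero, consPower_face_zero,
      consPower_front_succ]
  | q + 1, a + 1, h, F => by
    obtain ⟨x, F, rfl⟩ := exists_eq_consPower F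
    rw [consPower_front_succ, consPower_face_succ, consPower_face_succ, consPower_front_succ,
      comp_front_comp_face (Nat.le_of_succ_le_succ h) F]

theorem comp_face_comp_last : ∀ {q a : ℕ} (_ : a ≤ q) (F : P ⥤ᵖ Power B (q + 2)),
    (F.comp (G.face (q + 1) a)).comp (last B q) = F.comp (last B (q + 1))
  | 0, 0, _, F => by
    obtain ⟨x, F, rfl⟩ := exists_eq_consPower F
    obtain ⟨y, z, rfl⟩ := exists_eq_consPower F
    rw [consPower_last_succ, consPower_face_zero, consPower_last_zero, consPower_last_zero]
  | q + 1, 0, _, F => by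
    obtain ⟨x, F, rfl⟩ := exists_eq_consPower F
    obtain ⟨y, F, rfl⟩ := exists_eq_consPower F
    rw [consPower_last_succ, consPower_last_succ, consPower_face_zero, consPower_last_succ]
  | q + 1, a + 1, h, F => by
    obtain ⟨x, F, rfl⟩ := exists_eq_consPower F
    rw [consPower_face_succ, consPower_last_succ, consPower_last_succ,
      comp_face_comp_last (Nat.le_of_succ_le_succ h) F]

theorem comp_face_last_comp_front : ∀ {q : ℕ} (F : P ⥤ᵖ Power B (q + 2)),
    (F.comp (G.face (q + 1) (q + 1))).comp (front B q) =
      (F.comp (front B (q + 1))).comp (front B q)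
  | 0, F => by
    obtain ⟨x, F, rfl⟩ := exists_eq_consPower F
    rw [consPower_face_succ, consPower_front_succ, consPower_front_zero, consPower_front_zero]
  | q + 1, F => by
    obtain ⟨x, F, rfl⟩ := exists_eq_consPower F
    rw [consPower_face_succ, consPower_front_succ, consPower_front_succ, consPower_front_succ,
      comp_face_last_comp_front F]

/-- The index `q + 1` is the largest one in range: this face tensors the last two variables. -/
theorem comp_face_last_comp_last : ∀ {q : ℕ} (F : P ⥤ᵖ Power B (q + 2)),
    (F.comp (G.face (q + 1) (q + 1))).comp (last B q) =
      (pair ((F.comp (front B (q + 1))).comp (last B q)) (F.comp (last B (q + 1)))).comp G.tensor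
  | 0, F => by
    obtain ⟨x, F, rfl⟩ := exists_eq_consPower F
    obtain ⟨y, z, rfl⟩ := exists_eq_consPower F
    rw [consPower_face_succ, consPower_front_succ, consPower_last_zero, consPower_last_zero,
      consPower_last_succ, consPower_last_zero, consPower_front_zero]
    rfl
  | q + 1, F => by
    obtain ⟨x, F, rfl⟩ := exists_eq_consPower F
    rw [consPower_face_succ, consPower_front_succ, consPower_last_succ, consPower_last_succ,
      consPower_last_succ, comp_face_last_comp_last F]

end Faces

/-! ### Cosimplicial identities for the vertical cofaces. -/

section Columns

open TotalCochain

/-- A cochain of an iterated tensor product as a total cochain. -/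
def tot {p q : ℕ} (φ : Cochain (G.tens q) p) : TotalCochain (Power B q) B p := ⟨G.tens q, φ⟩

theorem tot_injective {p q : ℕ} {φ ψ : Cochain (G.tens q) p} (h : G.tot φ = G.tot ψ) : φ = ψ :=
  eq_of_heq (Sigma.mk.inj h).2

theorem tot_colFirst {p q : ℕ} (φ : Cochain (G.tens q) p) :
    G.tot (G.colFirst φ) = TotalCochain.tensor G.tensor (can (headPower B q) p)
      (pb (tailPower B q) (G.tot φ)) := rfl

theorem tot_colMiddle {p q : ℕ} (i : ℕ) (φ : Cochain (G.tens q) p) :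
    G.tot (G.colMiddle i φ) = pb (G.face q i) (G.tot φ) :=
  mk_transport (G.face_comp_tens q i) _

theorem tot_colLast {p q : ℕ} (φ : Cochain (G.tens q) p) :
    G.tot (G.colLast φ) =
      TotalCochain.tensor G.tensor (pb (front B q) (G.tot φ)) (can (last B q) p) :=
  mk_transport (G.front_tensor_last q) _

/-- This is (1 ⊗ 1) ⊗ φ = 1 ⊗ (1 ⊗ φ), where a tensor product of canonical cochains is canonical.
`colLast_colLast` is the mirror image. -/
theorem colMiddle_zero_colFirst {p q : ℕ} (φ : Cochain (G.tens q) p) :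
    G.colMiddle 0 (G.colFirst φ) = G.colFirst (G.colFirst φ) := by
  apply G.tot_injective
  rw [tot_colMiddle, tot_colFirst, tot_colFirst, tot_colFirst, pb_tensor, pb_tensor, pb_can,
    pb_can, pb_pb, pb_pb, ← tensor_assoc, tensor_can]
  refine congrArg₂ (TotalCochain.tensor G.tensor) (congrArg (can · p) ?_) (congrArg (pb · _) ?_)
  · exact pair_proj₁ _ _
  · exact pair_proj₂ _ _

theorem colMiddle_succ_colFirst {p q : ℕ} (i : ℕ) (φ : Cochain (G.tens q) p) :
    G.colMiddle (i + 1) (G.colFirst φ) = G.colFirst (G.colMiddle i φ) := by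
  apply G.tot_injective
  rw [tot_colMiddle, tot_colFirst, tot_colFirst, tot_colMiddle, pb_tensor, pb_can, pb_pb, pb_pb]
  refine congrArg₂ (TotalCochain.tensor G.tensor) (congrArg (can · p) ?_) (congrArg (pb · _) ?_)
  · exact pair_proj₁ _ _
  · exact pair_proj₂ _ _

/-- This is (1 ⊗ φ) ⊗ 1 = 1 ⊗ (φ ⊗ 1). -/
theorem colLast_colFirst {p q : ℕ} (φ : Cochain (G.tens q) p) :
    G.colLast (G.colFirst φ) = G.colFirst (G.colLast φ) := by
  apply G.tot_injective
  rw [tot_colLast, tot_colFirst, tot_colFirst, tot_colLast, pb_tensor, pb_tensor, pb_can, pb_can,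
    pb_pb, pb_pb, ← tensor_assoc]
  refine congrArg₂ (TotalCochain.tensor G.tensor) (congrArg₂ (TotalCochain.tensor G.tensor)
    (congrArg (can · p) ?_) (congrArg (pb · _) ?_)) rfl
  · exact pair_proj₁ _ _
  · exact pair_proj₂ _ _

theorem colMiddle_colMiddle {p q a c : ℕ} (h : a ≤ c) (h' : c ≤ q) (φ : Cochain (G.tens q) p) :
    G.colMiddle (c + 1) (G.colMiddle a φ) = G.colMiddle a (G.colMiddle c φ) := by
  apply G.tot_injective
  rw [tot_colMiddle, tot_colMiddle, tot_colMiddle, tot_colMiddle, pb_pb, pb_pb]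
  have e := G.comp_face_comp_face h h' (Pseudofunctor.id (Power B (q + 2)))
  rw [id_comp, id_comp] at e
  rw [e]

theorem colLast_colMiddle {p q a : ℕ} (h : a ≤ q) (φ : Cochain (G.tens q) p) :
    G.colLast (G.colMiddle a φ) = G.colMiddle a (G.colLast φ) := by
  apply G.tot_injective
  rw [tot_colLast, tot_colMiddle, tot_colMiddle, tot_colLast, pb_tensor, pb_can, pb_pb, pb_pb]
  have e := G.comp_front_comp_face h (Pseudofunctor.id (Power B (q + 2)))
  have e' := G.comp_face_comp_last h (Pseudofunctor.id (Power B (q + 2)))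
  rw [id_comp, id_comp] at e e'
  rw [e, e']

theorem colLast_colLast {p q : ℕ} (φ : Cochain (G.tens q) p) :
    G.colLast (G.colLast φ) = G.colMiddle (q + 1) (G.colLast φ) := by
  apply G.tot_injective
  rw [tot_colLast, tot_colMiddle, tot_colLast, pb_tensor, pb_tensor, pb_can, pb_can, pb_pb, pb_pb,
    tensor_assoc, tensor_can]
  have e := G.comp_face_last_comp_front (Pseudofunctor.id (Power B (q + 2)))
  have e' := G.comp_face_last_comp_last (Pseudofunctor.id (Power B (q + 2)))
  simp only [id_comp] at e e'
  rw [e, e']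

end Columns

end GraySemigroup
-- Cosimplicial identities for the horizontal cofaces.
section Rows

variable {C : Type u} [Bicategory.{w, v} C] {D : Type u₁} [Bicategory.{w₁, v₁} D]

namespace Path

theorem merge_cons_succ {p : ℕ} {X Y Z : C} (x : Path C (p + 1) X Y) (g : Y ⟶ Z) (i : ℕ) :
    (x.cons g).merge (i + 1) = (x.merge i).cons g := by
  cases x
  rfl

/-- The bound on `a` keeps the merge away from the new entry `f`: index `p + 1`, like every larger
one, would compose the two entries at the start of `x.snoc f`. -/
theorem merge_snoc : ∀ {p a : ℕ} (_ : a ≤ p) {W X Z : C} (f : W ⟶ X) (x : Path C (p + 1) X Z),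
    (x.snoc f).merge a = (x.merge a).snoc f
  | _, 0, _, _, _, _, _, .cons (.single _) _ => rfl
  | _, 0, _, _, _, _, _, .cons (.cons _ _) _ => rfl
  | 0, a + 1, h, _, _, _, _, _ => absurd h (Nat.not_succ_le_zero a)
  | p + 1, a + 1, h, _, _, _, f, .cons x g => by
    rw [merge_cons_succ, snoc, snoc, merge_cons_succ, merge_snoc (Nat.le_of_succ_le_succ h)]

theorem merge_snoc_snoc {V W : C} : ∀ {p : ℕ} {X Z : C} (f : V ⟶ W) (g : W ⟶ X) (x : Path C p X Z),
    ((x.snoc g).snoc f).merge (p + 1) = x.snoc (f ≫ g)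
  | _, _, _, _, _, .single _ => rfl
  | _, _, _, f, g, .cons x e => by
    rw [snoc, snoc, merge_cons_succ, merge_snoc_snoc, snoc]

variable [Strict C]

/-- After common entries are stripped, the only overlapping case is `a = c = 0`, where strict
associativity of composition is used; the other merges are disjoint. -/
theorem merge_merge : ∀ {p a c : ℕ} (_ : a ≤ c) (_ : c ≤ p) {X Z : C} (x : Path C (p + 2) X Z),
    (x.merge (c + 1)).merge a = (x.merge a).merge c
  | _, 0, 0, _, _, _, _, .cons (.cons (.single e) f) g =>
    congrArg Path.single (Strict.assoc e f g)
  | _, 0, 0, _, _, _, _, .cons (.cons (.cons x e) f) g =>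
    congrArg (Path.cons x) (Strict.assoc e f g)
  | 0, _, c + 1, _, h, _, _, _ => absurd h (Nat.not_succ_le_zero c)
  | _, a + 1, 0, h, _, _, _, _ => absurd h (Nat.not_succ_le_zero a)
  | p + 1, 0, c + 1, _, _, _, _, .cons (.cons x f) g => by
    rw [merge_cons_succ, merge_cons_succ]
    exact (merge_cons_succ x (f ≫ g) c).symm
  | p + 1, a + 1, c + 1, h, h', _, _, .cons x g => by
    rw [merge_cons_succ, merge_cons_succ, merge_cons_succ, merge_cons_succ,
      merge_merge (Nat.le_of_succ_le_succ h) (Nat.le_of_succ_le_succ h')]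

theorem mergeTo_eq_eqToHom : ∀ {p : ℕ} {X Z : C} (x : Path C (p + 1) X Z) (i : ℕ),
    ∃ h, x.mergeTo i = eqToHom h
  | _, _, _, .cons (.single _) _, _ => ⟨rfl, rfl⟩
  | _, _, _, .cons (.cons x f) g, 0 => ⟨(Strict.assoc x.comp f g).symm, by
      change (α_ x.comp f g).inv = _
      rw [Strict.associator_eqToIso]
      rfl⟩
  | _, _, _, .cons (.cons x f) g, i + 1 => by
    obtain ⟨h, e⟩ := mergeTo_eq_eqToHom (.cons x f) i
    refine ⟨congrArg (· ≫ g) h, ?_⟩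
    change (Path.cons x f).mergeTo i ▷ g = _
    rw [e, eqToHom_whiskerRight]
    rfl

theorem snocTo_eq_eqToHom : ∀ {p : ℕ} {W X Z : C} (f : W ⟶ X) (x : Path C p X Z),
    ∃ h, x.snocTo f = eqToHom h
  | _, _, _, _, _, .single _ => ⟨rfl, rfl⟩
  | _, _, _, _, f, .cons x g => by
    obtain ⟨h, e⟩ := snocTo_eq_eqToHom f x
    refine ⟨(Strict.assoc f x.comp g).symm.trans (congrArg (· ≫ g) h), ?_⟩
    change (α_ f x.comp g).inv ≫ x.snocTo f ▷ g = _
    rw [e, eqToHom_whiskerRight, Strict.associator_eqToIso]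
    exact eqToHom_trans (Strict.assoc f x.comp g).symm _

end Path

/-- Pairs of a 1-morphism `f` and an endomorphism of `F(f)`. -/
abbrev EndPair (F : C ⥤ᵖ D) (X Z : C) := Σ f : X ⟶ Z, F.map f ⟶ F.map f

namespace EndPair

/-- Over a strict source the canonical 2-morphisms between composites are `eqToHom`s. Conjugation by
one of them is invisible once an endomorphism is bundled with its 1-morphism, so the row identities
become plain equations that can be rewritten. -/
theorem mk_eq_mk (F : C ⥤ᵖ D) {X Z : C} {f g : X ⟶ Z} {a : F.map f ⟶ F.map f}
    {b : F.map g ⟶ F.map g} {θ : f ⟶ g} (e : ∃ h, θ = eqToHom h)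
    (h : a ≫ F.map₂ θ = F.map₂ θ ≫ b) : (⟨f, a⟩ : EndPair F X Z) = ⟨g, b⟩ := by
  obtain ⟨rfl, rfl⟩ := e
  rw [eqToHom_refl, F.map₂_id, Category.comp_id, Category.id_comp] at h
  rw [h]

/-- Postcompose with a 1-morphism. -/
def whiskerRight {F : C ⥤ᵖ D} {X Y Z : C} (a : EndPair F X Y) (g : Y ⟶ Z) : EndPair F X Z :=
  ⟨a.1 ≫ g, (F.mapComp a.1 g).hom ≫ a.2 ▷ F.map g ≫ (F.mapComp a.1 g).inv⟩

/-- Precompose with a 1-morphism. -/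
def whiskerLeft {F : C ⥤ᵖ D} {X Y Z : C} (f : X ⟶ Y) (a : EndPair F Y Z) : EndPair F X Z :=
  ⟨f ≫ a.1, (F.mapComp f a.1).hom ≫ F.map f ◁ a.2 ≫ (F.mapComp f a.1).inv⟩

theorem associator_hom_eq_eqToHom [Strict C] {W X Y Z : C} (f : W ⟶ X) (g : X ⟶ Y) (h : Y ⟶ Z) :
    ∃ e, (α_ f g h).hom = eqToHom e :=
  ⟨Strict.assoc f g h, by rw [Strict.associator_eqToIso]; rfl⟩

/-- Conjugating by the associator of C leaves an instance of the associativity coherence of F, which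
`simp` expands. The next two lemmas are its variants for the other sides. -/
theorem whiskerRight_whiskerRight [Strict C] {F : C ⥤ᵖ D} {W X Y Z : C} (a : EndPair F W X)
    (f : X ⟶ Y) (g : Y ⟶ Z) : (a.whiskerRight f).whiskerRight g = a.whiskerRight (f ≫ g) := by
  refine mk_eq_mk F (associator_hom_eq_eqToHom a.1 f g) ?_
  simp [whiskerRight, whisker_exchange_assoc]

theorem whiskerLeft_whiskerLeft [Strict C] {F : C ⥤ᵖ D} {W X Y Z : C} (f : W ⟶ X) (g : X ⟶ Y)
    (a : EndPair F Y Z) : whiskerLeft f (whiskerLeft g a) = whiskerLeft (f ≫ g) a := by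
  refine (mk_eq_mk F (associator_hom_eq_eqToHom f g a.1) ?_).symm
  simp [whiskerLeft, whisker_exchange_assoc]

theorem whiskerLeft_whiskerRight [Strict C] {F : C ⥤ᵖ D} {W X Y Z : C} (f : W ⟶ X)
    (a : EndPair F X Y) (g : Y ⟶ Z) :
    whiskerLeft f (a.whiskerRight g) = (whiskerLeft f a).whiskerRight g := by
  refine (mk_eq_mk F (associator_hom_eq_eqToHom f a.1 g) ?_).symm
  simp [whiskerLeft, whiskerRight]

end EndPair

/-- The component of a cochain at a path, as a pair. -/
noncomputable def ev {F : C ⥤ᵖ D} {p : ℕ} (φ : Cochain F p) {X Z : C} (x : Path C p X Z) :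
    EndPair F X Z :=
  ⟨x.comp, hat φ x⟩

theorem ev_ext {F : C ⥤ᵖ D} {p : ℕ} {φ ψ : Cochain F p}
    (h : ∀ {X Z : C} (x : Path C p X Z), ev φ x = ev ψ x) : φ = ψ :=
  hat_ext fun x => eq_of_heq (Sigma.mk.inj (h x)).2

theorem ev_firstCoface {F : C ⥤ᵖ D} {p : ℕ} (φ : Cochain F p) {X Y Z : C} (x : Path C p X Y)
    (g : Y ⟶ Z) : ev (firstCoface φ) (x.cons g) = (ev φ x).whiskerRight g :=
  congrArg (fun a => (⟨x.comp ≫ g, a⟩ : EndPair F X Z)) (hat_firstCoface φ x g)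

variable [Strict C]

theorem ev_middleCoface {F : C ⥤ᵖ D} {p : ℕ} (i : ℕ) (φ : Cochain F p) {X Z : C}
    (x : Path C (p + 1) X Z) : ev (middleCoface i φ) x = ev φ (x.merge i) :=
  (EndPair.mk_eq_mk F (x.mergeTo_eq_eqToHom i) (hat_middleCoface i φ x)).symm

theorem ev_lastCoface {F : C ⥤ᵖ D} {p : ℕ} (φ : Cochain F p) {W X Z : C} (f : W ⟶ X)
    (x : Path C p X Z) : ev (lastCoface φ) (x.snoc f) = (ev φ x).whiskerLeft f := by
  refine (EndPair.mk_eq_mk F (Path.snocTo_eq_eqToHom f x) ?_).symm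
  have h := hat_lastCoface φ f x
  rw [Category.assoc] at h
  change ((F.mapComp f x.comp).hom ≫ F.map f ◁ hat φ x ≫ (F.mapComp f x.comp).inv) ≫ _ = _
  rw [Category.assoc, Category.assoc, h, Iso.hom_inv_id_assoc]

theorem middleCoface_zero_firstCoface {F : C ⥤ᵖ D} {p : ℕ} (φ : Cochain F p) :
    middleCoface 0 (firstCoface φ) = firstCoface (firstCoface φ) := by
  refine ev_ext fun {X Z} x => ?_
  obtain _ | @⟨_, _, _, _, x, g⟩ := x
  obtain _ | @⟨_, _, _, _, x, f⟩ := x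
  rw [ev_middleCoface, ev_firstCoface, ev_firstCoface, EndPair.whiskerRight_whiskerRight]
  exact ev_firstCoface φ x (f ≫ g)

theorem middleCoface_succ_firstCoface {F : C ⥤ᵖ D} {p : ℕ} (i : ℕ) (φ : Cochain F p) :
    middleCoface (i + 1) (firstCoface φ) = firstCoface (middleCoface i φ) := by
  refine ev_ext fun {X Z} x => ?_
  obtain _ | @⟨_, _, _, _, x, g⟩ := x
  rw [ev_middleCoface, Path.merge_cons_succ, ev_firstCoface, ev_firstCoface, ev_middleCoface]

theorem lastCoface_firstCoface {F : C ⥤ᵖ D} {p : ℕ} (φ : Cochain F p) :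
    lastCoface (firstCoface φ) = firstCoface (lastCoface φ) := by
  refine ev_ext fun {X Z} x => ?_
  obtain ⟨Y, f, x, rfl⟩ := x.exists_eq_snoc
  obtain _ | @⟨_, _, _, _, x, g⟩ := x
  rw [ev_lastCoface, ev_firstCoface, EndPair.whiskerLeft_whiskerRight, Path.snoc, ev_firstCoface,
    ev_lastCoface]

theorem middleCoface_middleCoface {F : C ⥤ᵖ D} {p a c : ℕ} (h : a ≤ c) (h' : c ≤ p)
    (φ : Cochain F p) :
    middleCoface (c + 1) (middleCoface a φ) = middleCoface a (middleCoface c φ) := by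
  refine ev_ext fun {X Z} x => ?_
  rw [ev_middleCoface, ev_middleCoface, ev_middleCoface, ev_middleCoface, Path.merge_merge h h']

theorem lastCoface_middleCoface {F : C ⥤ᵖ D} {p a : ℕ} (h : a ≤ p) (φ : Cochain F p) :
    lastCoface (middleCoface a φ) = middleCoface a (lastCoface φ) := by
  refine ev_ext fun {X Z} x => ?_
  obtain ⟨Y, f, x, rfl⟩ := x.exists_eq_snoc
  rw [ev_lastCoface, ev_middleCoface, ev_middleCoface, Path.merge_snoc h, ev_lastCoface]

theorem lastCoface_lastCoface {F : C ⥤ᵖ D} {p : ℕ} (φ : Cochain F p) :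
    lastCoface (lastCoface φ) = middleCoface (p + 1) (lastCoface φ) := by
  refine ev_ext fun {X Z} x => ?_
  obtain ⟨Y, f, x, rfl⟩ := x.exists_eq_snoc
  obtain ⟨W, g, x, rfl⟩ := x.exists_eq_snoc
  rw [ev_lastCoface, ev_lastCoface, ev_middleCoface, Path.merge_snoc_snoc, ev_lastCoface,
    EndPair.whiskerLeft_whiskerLeft]

end Rows
-- Alternating sums of cofaces.
section AlternatingSums

variable {K : Type*} [CommRing K] {M₀ M₁ M₂ : Type*} [AddCommGroup M₀] [Module K M₀]
  [AddCommGroup M₁] [Module K M₁] [AddCommGroup M₂] [Module K M₂]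

/-- The terms cancel in pairs: (j, i) with i < j is matched with (i, j - 1), and (j, i) with j ≤ i
with (i + 1, j). The values agree by `h`, and the index sums differ by one, so the signs are
opposite. -/
theorem sum_alternating_eq_zero (n : ℕ) (g : ℕ → ℕ → M₂)
    (h : ∀ a c, a ≤ c → c ≤ n → g (c + 1) a = g a c) :
    ∑ x ∈ Finset.range (n + 2) ×ˢ Finset.range (n + 1), (-1 : K) ^ (x.1 + x.2) • g x.1 x.2 = 0 := by
  refine Finset.sum_involution
    (fun x _ => if x.2 < x.1 then (x.2, x.1 - 1) else (x.2 + 1, x.1)) ?_ ?_ ?_ ?_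
  · rintro ⟨j, i⟩ hx
    simp only [Finset.mem_product, Finset.mem_range] at hx
    dsimp only
    split_ifs with hij
    · obtain ⟨c, rfl⟩ : ∃ c, j = c + 1 := ⟨j - 1, by omega⟩
      rw [h i c (by omega) (by omega), Nat.add_sub_cancel, ← add_smul,
        show c + 1 + i = i + c + 1 by omega, pow_succ]
      simp
    · rw [h j i (by omega) (by omega), ← add_smul, show i + 1 + j = j + i + 1 by omega, pow_succ]
      simp
  · rintro ⟨j, i⟩ _ _
    dsimp only
    split_ifs with hij <;> simp only [ne_eq, Prod.mk.injEq] <;> omega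
  · rintro ⟨j, i⟩ hx
    simp only [Finset.mem_product, Finset.mem_range] at hx ⊢
    split_ifs with hij <;> dsimp only <;> omega
  · rintro ⟨j, i⟩ hx
    simp only [Finset.mem_product, Finset.mem_range] at hx
    dsimp only
    by_cases hij : i < j
    · simp only [if_pos hij, if_neg (show ¬ j - 1 < i by omega)]
      exact Prod.ext (Nat.sub_add_cancel (by omega)) rfl
    · simp only [if_neg hij, if_pos (show j < i + 1 by omega)]
      rfl

/-- The alternating sum of the cofaces `f`, `m 0, …, m n` and `l`. -/
def alternating (n : ℕ) (f : M₀ →ₗ[K] M₁) (m : ℕ → M₀ →ₗ[K] M₁) (l : M₀ →ₗ[K] M₁) :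
    M₀ →ₗ[K] M₁ :=
  f + ∑ i ∈ Finset.range (n + 1), (-1 : K) ^ (i + 1) • m i + (-1 : K) ^ (n + 2) • l

theorem alternating_apply (n : ℕ) (f : M₀ →ₗ[K] M₁) (m : ℕ → M₀ →ₗ[K] M₁) (l : M₀ →ₗ[K] M₁)
    (x : M₀) : alternating n f m l x =
      f x + ∑ i ∈ Finset.range (n + 1), (-1 : K) ^ (i + 1) • m i x + (-1 : K) ^ (n + 2) • l x := by
  simp [alternating, LinearMap.sum_apply]

/-- With d⁰ = f, dⁱ⁺¹ = mᵢ and dⁿ⁺² = l the hypotheses are the cosimplicial identities. The end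
cofaces are kept apart because only the middle ones form an indexed family. -/
theorem alternating_comp_alternating (n : ℕ) {f : M₀ →ₗ[K] M₁} {m : ℕ → M₀ →ₗ[K] M₁}
    {l : M₀ →ₗ[K] M₁} {f' : M₁ →ₗ[K] M₂} {m' : ℕ → M₁ →ₗ[K] M₂} {l' : M₁ →ₗ[K] M₂}
    (hmf₀ : ∀ x, m' 0 (f x) = f' (f x)) (hmf : ∀ i x, m' (i + 1) (f x) = f' (m i x))
    (hlf : ∀ x, l' (f x) = f' (l x))
    (hmm : ∀ a c, a ≤ c → c ≤ n → ∀ x, m' (c + 1) (m a x) = m' a (m c x))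
    (hlm : ∀ a, a ≤ n → ∀ x, l' (m a x) = m' a (l x)) (hll : ∀ x, l' (l x) = m' (n + 1) (l x)) :
    alternating (n + 1) f' m' l' ∘ₗ alternating n f m l = 0 := by
  ext x
  rw [LinearMap.comp_apply, alternating_apply n, alternating_apply]
  simp only [map_add, map_sum, map_smul, Finset.sum_add_distrib, smul_add, Finset.smul_sum,
    smul_smul]
  -- The term j = 0 will cancel f'f, and the terms with j = i + 1 will cancel f'mᵢ.
  have h₁ : ∑ j ∈ Finset.range (n + 1 + 1), (-1 : K) ^ (j + 1) • m' j (f x) =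
      -f' (f x) - ∑ i ∈ Finset.range (n + 1), (-1 : K) ^ (i + 1) • f' (m i x) := by
    rw [Finset.sum_range_succ', add_comm, hmf₀, sub_eq_add_neg, ← Finset.sum_neg_distrib]
    simp [hmf, pow_succ]
  have h₂ : ∑ j ∈ Finset.range (n + 1 + 1), ∑ i ∈ Finset.range (n + 1),
      ((-1 : K) ^ (j + 1) * (-1) ^ (i + 1)) • m' j (m i x) = 0 := by
    rw [← Finset.sum_product', ← sum_alternating_eq_zero (K := K) n (fun j i => m' j (m i x))
      (fun a c h h' => hmm a c h h' x)]
    refine Finset.sum_congr rfl fun y _ => ?_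
    congr 1
    ring
  -- The term j = n + 1 becomes l'l, with sign +1; the earlier ones become l'mⱼ and meet the
  -- opposite sign in `h₅`.
  have h₃ : ∑ j ∈ Finset.range (n + 1 + 1), ((-1 : K) ^ (j + 1) * (-1) ^ (n + 2)) • m' j (l x) =
      ∑ i ∈ Finset.range (n + 1), ((-1 : K) ^ (i + 1) * (-1) ^ (n + 2)) • l' (m i x) +
        l' (l x) := by
    rw [Finset.sum_range_succ, hll]
    congr 1
    · refine Finset.sum_congr rfl fun i hi => ?_
      rw [hlm i (by simpa [Nat.lt_succ_iff] using hi)]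
    · rw [← pow_add, Even.neg_one_pow ⟨n + 2, by ring⟩, one_smul]
  have h₄ : ((-1 : K) ^ (n + 1 + 2) * (-1) ^ (n + 2)) = -1 := by
    rw [← pow_add, Odd.neg_one_pow ⟨n + 2, by ring⟩]
  have h₅ : ∑ i ∈ Finset.range (n + 1), ((-1 : K) ^ (n + 1 + 2) * (-1) ^ (i + 1)) • l' (m i x) =
      -∑ i ∈ Finset.range (n + 1), ((-1 : K) ^ (i + 1) * (-1) ^ (n + 2)) • l' (m i x) := by
    rw [← Finset.sum_neg_distrib]
    refine Finset.sum_congr rfl fun i _ => ?_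
    rw [← neg_smul]
    congr 1
    ring
  rw [h₁, h₂, h₃, h₄, h₅, hlf, LinearMap.zero_apply, pow_succ (-1 : K) (n + 2)]
  simp only [mul_neg, mul_one, neg_smul, one_smul]
  abel

theorem comp_alternating {N₀ N₁ : Type*} [AddCommGroup N₀] [Module K N₀] [AddCommGroup N₁]
    [Module K N₁] (n : ℕ) {f : M₀ →ₗ[K] M₁} {m : ℕ → M₀ →ₗ[K] M₁} {l : M₀ →ₗ[K] M₁}
    {f' : N₀ →ₗ[K] N₁} {m' : ℕ → N₀ →ₗ[K] N₁} {l' : N₀ →ₗ[K] N₁} {d : M₀ →ₗ[K] N₀}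
    {d' : M₁ →ₗ[K] N₁} (hf : ∀ x, d' (f x) = f' (d x)) (hm : ∀ i x, d' (m i x) = m' i (d x))
    (hl : ∀ x, d' (l x) = l' (d x)) :
    d' ∘ₗ alternating n f m l = alternating n f' m' l' ∘ₗ d := by
  ext x
  rw [LinearMap.comp_apply, LinearMap.comp_apply, alternating_apply, alternating_apply]
  simp only [map_add, map_sum, map_smul, hf, hm, hl]

end AlternatingSums

/-! ### The horizontal coboundary as an alternating sum. -/

section RowCofaces

variable (K : Type*) [CommRing K] {C : Type u} [Bicategory.{w, v} C] {D : Type u₁}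
  [Bicategory.{w₁, v₁} D] [∀ X Y : D, Preadditive (X ⟶ Y)] [∀ X Y : D, Linear K (X ⟶ Y)]
  [IsLinear K D] (F : C ⥤ᵖ D) (p : ℕ)

/-- `firstCoface` as a linear map. -/
def firstCofaceₗ : Cochain F p →ₗ[K] Cochain F (p + 1) where
  toFun := firstCoface
  map_add' φ ψ := by
    funext X Z s
    exact rowFirst_add (K := K) F φ ψ s
  map_smul' r φ := by
    funext X Z s
    exact rowFirst_smul F r φ s

/-- `middleCoface` as a linear map. -/
def middleCofaceₗ (i : ℕ) : Cochain F p →ₗ[K] Cochain F (p + 1) where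
  toFun := middleCoface i
  map_add' φ ψ := by
    funext X Z s
    exact rowMiddle_add F i φ ψ s
  map_smul' r φ := by
    funext X Z s
    exact rowMiddle_smul F i r φ s

/-- `lastCoface` as a linear map. -/
def lastCofaceₗ : Cochain F p →ₗ[K] Cochain F (p + 1) where
  toFun := lastCoface
  map_add' φ ψ := by
    funext X Z s
    exact rowLast_add (K := K) F φ ψ s
  map_smul' r φ := by
    funext X Z s
    exact rowLast_smul F r φ s

theorem rowCoboundary_eq_alternating : rowCoboundary K F p =
    alternating p (firstCofaceₗ K F p) (middleCofaceₗ K F p) (lastCofaceₗ K F p) := by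
  refine LinearMap.ext fun φ => ?_
  rw [alternating_apply]
  funext X Z s
  simp only [Pi.add_apply, Finset.sum_apply, Pi.smul_apply]
  rfl

theorem rowCoboundary_comp_rowCoboundary [Strict C] :
    rowCoboundary K F (p + 1) ∘ₗ rowCoboundary K F p = 0 := by
  rw [rowCoboundary_eq_alternating, rowCoboundary_eq_alternating]
  exact alternating_comp_alternating p middleCoface_zero_firstCoface
    middleCoface_succ_firstCoface lastCoface_firstCoface
    (fun _ _ h h' => middleCoface_middleCoface h h') (fun _ h => lastCoface_middleCoface h)
    lastCoface_lastCoface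

end RowCofaces

/-- The row identities need a strict source, and the source of ⊗(q + 1) is this power. -/
instance strictPower (B : Type u) [Bicategory.{w, v} B] [h : Strict B] :
    ∀ q : ℕ, Strict (Power B q)
  | 0 => h
  | q + 1 =>
    have := strictPower B q
    inferInstanceAs (Strict (B × Power B q))

/-! ### The vertical coboundary, and commutation of the two. -/

namespace GraySemigroup

variable {K : Type*} [CommRing K] {B : Type u} [Bicategory.{w, v} B]
  [∀ X Y : B, Preadditive (X ⟶ Y)] [∀ X Y : B, Linear K (X ⟶ Y)] (G : GraySemigroup K B)
  (p q : ℕ)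

/-- `colFirst` as a linear map. -/
def colFirstₗ : G.X p q →ₗ[K] G.X p (q + 1) where
  toFun := G.colFirst
  map_add' := G.colFirst_add
  map_smul' := G.colFirst_smul

/-- `colMiddle` as a linear map. -/
def colMiddleₗ (i : ℕ) : G.X p q →ₗ[K] G.X p (q + 1) where
  toFun := G.colMiddle i
  map_add' := G.colMiddle_add i
  map_smul' := G.colMiddle_smul i

/-- `colLast` as a linear map. -/
def colLastₗ : G.X p q →ₗ[K] G.X p (q + 1) where
  toFun := G.colLast
  map_add' := G.colLast_add
  map_smul' := G.colLast_smul

theorem δv_eq_alternating :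
    G.δv p q = alternating q (G.colFirstₗ p q) (G.colMiddleₗ p q) (G.colLastₗ p q) := by
  refine LinearMap.ext fun φ => ?_
  rw [alternating_apply]
  rfl

theorem δv_comp_δv : G.δv p (q + 1) ∘ₗ G.δv p q = 0 := by
  rw [δv_eq_alternating, δv_eq_alternating]
  refine alternating_comp_alternating q (fun φ => ?_) (fun i φ => ?_) (fun φ => ?_)
    (fun a c h h' φ => ?_) (fun a h φ => ?_) (fun φ => ?_)
  · exact G.colMiddle_zero_colFirst φ
  · exact G.colMiddle_succ_colFirst i φ
  · exact G.colLast_colFirst φ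
  · exact G.colMiddle_colMiddle h h' φ
  · exact G.colLast_colMiddle h φ
  · exact G.colLast_colLast φ

variable {p q}

/-- The column coface is a canonical cochain tensored with a pullback, and the row coface passes
through the tensor product, fixes canonical cochains up to degree and passes through the pullback.
The eight lemmas that follow combine the same facts, with transport where the column coface contains
one. -/
theorem firstCoface_colFirst (φ : G.X p q) :
    firstCoface (G.colFirst φ) = G.colFirst (firstCoface φ) :=
  (firstCoface_tensorCochain G.tensor (headPower B q) ((tailPower B q).comp (G.tens q)) _ _).trans
    (congrArg₂ (tensorCochain G.tensor _ _) (firstCoface_canonical (headPower B q) p)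
      (firstCoface_pullback (tailPower B q) φ))

theorem middleCoface_colFirst (i : ℕ) (φ : G.X p q) :
    middleCoface i (G.colFirst φ) = G.colFirst (middleCoface i φ) :=
  (middleCoface_tensorCochain G.tensor (headPower B q) ((tailPower B q).comp (G.tens q))
    i _ _).trans
    (congrArg₂ (tensorCochain G.tensor _ _) (middleCoface_canonical (headPower B q) p i)
      (middleCoface_pullback (tailPower B q) i φ))

theorem lastCoface_colFirst (φ : G.X p q) :
    lastCoface (G.colFirst φ) = G.colFirst (lastCoface φ) :=
  (lastCoface_tensorCochain G.tensor (headPower B q) ((tailPower B q).comp (G.tens q)) _ _).trans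
    (congrArg₂ (tensorCochain G.tensor _ _) (lastCoface_canonical (headPower B q) p)
      (lastCoface_pullback (tailPower B q) φ))

theorem firstCoface_colMiddle (j : ℕ) (φ : G.X p q) :
    firstCoface (G.colMiddle j φ) = G.colMiddle j (firstCoface φ) := by
  rw [colMiddle, firstCoface_transport, firstCoface_pullback, colMiddle]

theorem middleCoface_colMiddle (i j : ℕ) (φ : G.X p q) :
    middleCoface i (G.colMiddle j φ) = G.colMiddle j (middleCoface i φ) := by
  rw [colMiddle, middleCoface_transport, middleCoface_pullback, colMiddle]

theorem lastCoface_colMiddle (j : ℕ) (φ : G.X p q) :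
    lastCoface (G.colMiddle j φ) = G.colMiddle j (lastCoface φ) := by
  rw [colMiddle, lastCoface_transport, lastCoface_pullback, colMiddle]

theorem firstCoface_colLast (φ : G.X p q) :
    firstCoface (G.colLast φ) = G.colLast (firstCoface φ) := by
  rw [colLast, firstCoface_transport, firstCoface_tensorCochain, firstCoface_canonical,
    firstCoface_pullback, colLast]

theorem middleCoface_colLast (i : ℕ) (φ : G.X p q) :
    middleCoface i (G.colLast φ) = G.colLast (middleCoface i φ) := by
  rw [colLast, middleCoface_transport, middleCoface_tensorCochain, middleCoface_canonical,
    middleCoface_pullback, colLast]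

theorem lastCoface_colLast (φ : G.X p q) :
    lastCoface (G.colLast φ) = G.colLast (lastCoface φ) := by
  rw [colLast, lastCoface_transport, lastCoface_tensorCochain, lastCoface_canonical,
    lastCoface_pullback, colLast]

variable [IsLinear K B]

theorem δh_apply (φ : G.X p q) : G.δh p q φ = firstCoface φ +
    ∑ i ∈ Finset.range (p + 1), (-1 : K) ^ (i + 1) • middleCoface i φ +
      (-1 : K) ^ (p + 2) • lastCoface φ :=
  (congrArg (· φ) (rowCoboundary_eq_alternating K (G.tens q) p)).trans (alternating_apply _ _ _ _ _)

/-- A linear map that commutes with the cofaces of the rows commutes with the horizontal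
coboundary. -/
theorem δh_comm {q' : ℕ} (c : ∀ p, G.X p q →ₗ[K] G.X p q')
    (hf : ∀ φ : G.X p q, firstCoface (c p φ) = c (p + 1) (firstCoface φ))
    (hm : ∀ (i : ℕ) (φ : G.X p q), middleCoface i (c p φ) = c (p + 1) (middleCoface i φ))
    (hl : ∀ φ : G.X p q, lastCoface (c p φ) = c (p + 1) (lastCoface φ)) (φ : G.X p q) :
    G.δh p q' (c p φ) = c (p + 1) (G.δh p q φ) := by
  rw [δh_apply, δh_apply, map_add, map_add, map_sum, map_smul, hf, hl]
  simp only [map_smul, hm]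

/-- Only the vertical coboundary is expanded into cofaces; by `δh_comm` each of them commutes with
the whole horizontal coboundary. -/
theorem δh_comp_δv : G.δh p (q + 1) ∘ₗ G.δv p q = G.δv (p + 1) q ∘ₗ G.δh p q := by
  rw [δv_eq_alternating, δv_eq_alternating]
  refine comp_alternating q (fun φ => ?_) (fun j φ => ?_) (fun φ => ?_)
  · exact G.δh_comm (fun p => G.colFirstₗ p q) G.firstCoface_colFirst G.middleCoface_colFirst
      G.lastCoface_colFirst φ
  · exact G.δh_comm (fun p => G.colMiddleₗ p q j) (G.firstCoface_colMiddle j)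
      (fun i => G.middleCoface_colMiddle i j) (G.lastCoface_colMiddle j) φ
  · exact G.δh_comm (fun p => G.colLastₗ p q) G.firstCoface_colLast G.middleCoface_colLast
      G.lastCoface_colLast φ

end GraySemigroup
end GrayComplex

theorem mainTheorem3 {K : Type*} [CommRing K] {B : Type u} [Bicategory.{w, v} B]
    [∀ X Y : B, Preadditive (X ⟶ Y)] [∀ X Y : B, Linear K (X ⟶ Y)] [Bicategory.Strict B]
    [GrayComplex.IsLinear K B] (G : GrayComplex.GraySemigroup K B) :
    (∀ p q : ℕ, G.δh (p + 1) q ∘ₗ G.δh p q = 0) ∧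
    (∀ p q : ℕ, G.δv p (q + 1) ∘ₗ G.δv p q = 0) ∧
    (∀ p q : ℕ, G.δh p (q + 1) ∘ₗ G.δv p q = G.δv (p + 1) q ∘ₗ G.δh p q) :=
  ⟨fun p q => GrayComplex.rowCoboundary_comp_rowCoboundary K (G.tens q) p, G.δv_comp_δv,
    fun _ _ => G.δh_comp_δv⟩
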